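/- **Theorem 3.2.** Let $m\ge 2$, $d\ge 3$, and let $K$ be an infinite field with $\operatorname{char}K=0$ or $\operatorname{char}K>d$. Let $$R=K[x_{i_1,\dots,i_m},\,y_1,\dots,y_m : i_1+\cdots+i_m=d-1]$$ act by contraction on the divided power algebra $S=K_{DP}[X_{i_1,\dots,i_m},Y_1,\dots,Y_m : i_1+\cdots+i_m=d-1]$. For $G\in S$ put $\operatorname{Ann}_R G=\{f\in R: f\circ G=0\}$ and $A_G=R/\operatorname{Ann}_R G$. Let $$F=\sum_{i_1+\cdots+i_m=d-1}X_{i_1,\dots,i_m}Y_1^{i_1}\cdots Y_m^{i_m},$$ so that $A_F$ is the full Perazzo algebra in canonical form, and let $$\ell=\sum_{i_1+\cdots+i_m=d-1}a_{i_1,\dots,i_m}x_{i_1,\dots,i_m}+\sum_{j=1}^m b_jy_j\in[A_F]_1,\qquad c=\sum_{i_1+\cdots+i_m=d-1}\frac{(d-1)!}{i_1!\cdots i_m!}\,a_{i_1,\dots,i_m}\,b_1^{i_1}\cdots b_m^{i_m}\in K .$$ The Jordan type $P_{\ell,A_F}$ is the partition of $\dim_KA_F$ formed by the block sizes of the Jordan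 canonical form of $\times\ell:A_F\to A_F$, i.e. by the lengths $p_k$ of the strings $z_k,\ell z_k,\dots,\ell^{p_k-1}z_k$ (with $\ell^{p_k}z_k=0$) of a Jordan basis. The Jordan degree type $\mathcal S_{\ell,A_F}$ is the collection of pairs $(p_k)_{\nu_k}$, for a Jordan basis whose strings start at homogeneous elements $z_k$ of degree $\nu_k$. Exponents denote multiplicities. Then the Jordan type of $\ell$ is one of the following three. 1. If $b\ne0$ and $c=0$, then $$P_{\ell,A_F}=\Bigl(d^2,(d-1)^{2\binom{m-1}{m-2}},(d-2)^{2\binom{m}{m-2}},\dots,1^{2\binom{m+d-3}{m-2}}\Bigr)$$ (two parts $d$, and $2\binom{m+d-2-p}{m-2}$ parts $p$ for each $1\le p\le d-1$), and $$\mathcal S_{\ell,A_F}=\Bigl(d_0,d_1,(d-1)_1^{2\binom{m-1}{m-2}},(d-2)_1^{\binom{m}{m-2}},(d-2)_2^{\binom{m}{m-2}},\dots,1_1^{\binom{m+d-3}{m-2}},1_{d-1}^{\binom{m+d-3}{m-2}}\Bigr).$$ 2. If $b\neq 0$ and $c\ne0$, then $$P_{\ell,A_F}=\Bigl(d+1,(d-1)^{2m-1},(d-2)^{2\binom{m}{m-2}},\dots,1^{2\binom{m+d-3}{m-2}}\Bigr)$$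 and $$\mathcal S_{\ell,A_F}=\Bigl((d+1)_0,(d-1)_1^{2m-1},(d-2)_1^{\binom{m}{m-2}},(d-2)_2^{\binom{m}{m-2}},\dots,1_1^{\binom{m+d-3}{m-2}},1_{d-1}^{\binom{m+d-3}{m-2}}\Bigr).$$ (In both degree types the part $p$, for $1\le p\le d-2$, occurs $\binom{m+d-2-p}{m-2}$ times with index $1$ and $\binom{m+d-2-p}{m-2}$ times with index $d-p$.) 3. If $b=0$, i.e. $\ell$ is a combination of the $x$-variables only, then $P_{\ell,A_F}=(2^r,1^t)$, where $r=\dim_KA_{\ell\circ F}$ and $2r+t=\dim_KA_F$. -/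

import Mathlib

open MvPolynomial

noncomputable section

/-- The divided power algebra `K_DP[X_s : s ∈ σ]`, as a vector space: it has the basis of divided
monomials `X^[t]`, indexed by exponent vectors `t : σ →₀ ℕ` (`X^[t]` is `Finsupp.single t 1`).
Only its structure of a module over the polynomial ring (by contraction) is needed. -/
abbrev DPSpace (σ K : Type*) [Field K] : Type _ := (σ →₀ ℕ) →₀ K

/-- Contraction by the monomial `x^u`: `x^u ∘ X^[t] = X^[t - u]` if `u ≤ t`, and `0` otherwise.
On coefficients: the coefficient of `x^u ∘ G` at `t` is the coefficient of `G` at `t + u`. -/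
def contractMonomial (σ K : Type*) [Field K] (u : σ →₀ ℕ) : Module.End K (DPSpace σ K) :=
  Finsupp.lcomapDomain (fun t => t + u) (add_left_injective u)

/-- Contraction by monomials is multiplicative: `x^(u+v) ∘ G = x^u ∘ (x^v ∘ G)`. -/
def contractHom (σ K : Type*) [Field K] :
    Multiplicative (σ →₀ ℕ) →* Module.End K (DPSpace σ K) where
  toFun u := contractMonomial σ K u.toAdd
  map_one' := by
    ext t s
    simp [contractMonomial, Finsupp.lcomapDomain]
  map_mul' := by
    intro u v
    refine LinearMap.ext fun G => Finsupp.ext fun t => ?_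
    simp [contractMonomial, Finsupp.lcomapDomain, add_assoc]

/-- The contraction action of the polynomial ring `K[x_s : s ∈ σ]` on the divided power algebra,
as an algebra homomorphism to its linear endomorphisms: `contract f G` is `f ∘ G`. -/
def contract {σ K : Type*} [Field K] : MvPolynomial σ K →ₐ[K] Module.End K (DPSpace σ K) :=
  AddMonoidAlgebra.lift K (Module.End K (DPSpace σ K)) (σ →₀ ℕ) (contractHom σ K)

/-- The annihilator ideal `Ann_R(G) = {f ∈ R : f ∘ G = 0}`. -/
def annIdeal {σ K : Type*} [Field K] (G : DPSpace σ K) : Ideal (MvPolynomial σ K) where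
  carrier := {f | contract f G = 0}
  add_mem' := by
    intro f g hf hg
    simp only [Set.mem_ofPred_eq, map_add, LinearMap.add_apply] at *
    rw [hf, hg, add_zero]
  zero_mem' := by simp
  smul_mem' := by
    intro f g hg
    simp only [Set.mem_ofPred_eq, smul_eq_mul, map_mul, Module.End.mul_apply] at *
    rw [hg, map_zero]

/-- The algebra `A_G = R / Ann_R(G)` with Macaulay dual generator `G`. -/
abbrev MacaulayAlg {σ K : Type*} [Field K] (G : DPSpace σ K) : Type _ :=
  MvPolynomial σ K ⧸ annIdeal G

/-- The degree `ν` component `[A_G]_ν`: the classes of the forms of degree `ν`. -/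
def gradedPiece {σ K : Type*} [Field K] (G : DPSpace σ K) (ν : ℕ) :
    Submodule K (MacaulayAlg G) :=
  (homogeneousSubmodule σ K ν).map (Ideal.Quotient.mkₐ K (annIdeal G)).toLinearMap

/-- The vectors `ℓ^i z_k` (for `0 ≤ i < p_k`) form a Jordan basis of the algebra `A` for
multiplication by `ℓ`: they are a basis of `A`, and `ℓ^{p_k} z_k = 0` for all `k`. -/
structure IsJordanBasis (K : Type*) {A : Type*} [Field K] [CommRing A] [Algebra K A] (ℓ : A)
    {s : ℕ} (p : Fin s → ℕ) (z : Fin s → A) : Prop where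
  pos : ∀ k, 0 < p k
  pow_mul_eq_zero : ∀ k, ℓ ^ p k * z k = 0
  linearIndependent :
    LinearIndependent K (fun q : (Σ k : Fin s, Fin (p k)) => ℓ ^ (q.2 : ℕ) * z q.1)
  span_eq_top :
    Submodule.span K (Set.range fun q : (Σ k : Fin s, Fin (p k)) => ℓ ^ (q.2 : ℕ) * z q.1) = ⊤

/-- `P` is the Jordan type of `ℓ` in the algebra `A`, i.e. the partition (as a multiset) formed by
the sizes of the blocks in the Jordan canonical form of the nilpotent map `×ℓ : A → A`, that is, by
the lengths of the strings of a Jordan basis. -/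
def IsJordanType (K : Type*) {A : Type*} [Field K] [CommRing A] [Algebra K A] (ℓ : A)
    (P : Multiset ℕ) : Prop :=
  ∃ (s : ℕ) (p : Fin s → ℕ) (z : Fin s → A),
    IsJordanBasis K ℓ p z ∧ Finset.univ.val.map p = P

/-- `S` is the Jordan degree type of `ℓ` in the graded algebra `A_G`: the multiset of the pairs
`(p_k, ν_k)`, where the `p_k` are the lengths of the strings of a Jordan basis which start at
homogeneous elements `z_k`, and `ν_k` is the degree of `z_k`. -/
def IsJordanDegreeType {σ K : Type*} [Field K] (G : DPSpace σ K) (ℓ : MacaulayAlg G)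
    (S : Multiset (ℕ × ℕ)) : Prop :=
  ∃ (s : ℕ) (p ν : Fin s → ℕ) (z : Fin s → MacaulayAlg G),
    IsJordanBasis K ℓ p z ∧ (∀ k, z k ∈ gradedPiece G (ν k)) ∧
      Finset.univ.val.map (fun k => (p k, ν k)) = S

/-- The exponent vectors `(i_1, …, i_m)` with `i_1 + ⋯ + i_m = d - 1`. -/
abbrev PerazzoIdx (m d : ℕ) : Type :=
  {i : Fin m → ℕ // i ∈ Finset.piAntidiag (Finset.univ : Finset (Fin m)) (d - 1)}

/-- The variables: `Sum.inl i` stands for `x_{i_1,…,i_m}` and `Sum.inr k` for `y_k`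
(in the divided power algebra: for `X_{i_1,…,i_m}` and `Y_k`). -/
abbrev PerazzoVar (m d : ℕ) : Type := PerazzoIdx m d ⊕ Fin m

/-- The form `F = ∑_{i_1+⋯+i_m=d-1} X_{i_1,…,i_m} Y_1^{i_1} ⋯ Y_m^{i_m}`, a sum of monomials of the
divided power algebra. -/
def fullPerazzoForm (K : Type*) [Field K] (m d : ℕ) : DPSpace (PerazzoVar m d) K :=
  ∑ i : PerazzoIdx m d,
    Finsupp.single
      (Finsupp.single (Sum.inl i) 1 + ∑ k : Fin m, Finsupp.single (Sum.inr k) (i.1 k)) 1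

/-- The linear form `ℓ = ∑ a_i x_i + ∑ b_k y_k` of the polynomial ring. -/
def linForm {K : Type*} [Field K] {m d : ℕ} (a : PerazzoIdx m d → K) (b : Fin m → K) :
    MvPolynomial (PerazzoVar m d) K :=
  ∑ i, C (a i) * X (Sum.inl i) + ∑ k, C (b k) * X (Sum.inr k)

/-- `(d^2, (d-1)^{2 C(m-1,m-2)}, (d-2)^{2 C(m,m-2)}, …, 1^{2 C(m+d-3,m-2)})`: two parts `d`, and
`2 C(m+d-2-p, m-2)` parts `p` for each `1 ≤ p ≤ d - 1`. -/
def middleType (m d : ℕ) : Multiset ℕ :=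
  Multiset.replicate 2 d +
    ∑ p ∈ Finset.Icc 1 (d - 1), Multiset.replicate (2 * (m + d - 2 - p).choose (m - 2)) p

/-- `(d+1, (d-1)^{2m-1}, (d-2)^{2 C(m,m-2)}, …, 1^{2 C(m+d-3,m-2)})`. -/
def maxType (m d : ℕ) : Multiset ℕ :=
  {d + 1} + Multiset.replicate (2 * m - 1) (d - 1) +
    ∑ p ∈ Finset.Icc 1 (d - 2), Multiset.replicate (2 * (m + d - 2 - p).choose (m - 2)) p

/-- The common tail `((d-2)_1^{C(m,m-2)}, (d-2)_2^{C(m,m-2)}, …, 1_1^{C(m+d-3,m-2)},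
1_{d-1}^{C(m+d-3,m-2)})` of the two Jordan degree types; `p_ν` is the pair `(p, ν)`. -/
def degreeTail (m d : ℕ) : Multiset (ℕ × ℕ) :=
  ∑ p ∈ Finset.Icc 1 (d - 2),
    (Multiset.replicate ((m + d - 2 - p).choose (m - 2)) (p, 1) +
      Multiset.replicate ((m + d - 2 - p).choose (m - 2)) (p, d - p))

/-- `(d_0, d_1, (d-1)_1^{2 C(m-1,m-2)}, …)`. -/
def middleDegreeType (m d : ℕ) : Multiset (ℕ × ℕ) :=
  {(d, 0)} + {(d, 1)} + Multiset.replicate (2 * (m - 1).choose (m - 2)) (d - 1, 1) +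
    degreeTail m d

/-- `((d+1)_0, (d-1)_1^{2m-1}, …)`. -/
def maxDegreeType (m d : ℕ) : Multiset (ℕ × ℕ) :=
  {(d + 1, 0)} + Multiset.replicate (2 * m - 1) (d - 1, 1) + degreeTail m d

/-- `∑_{i_1+⋯+i_m=d-1} ((d-1)! / (i_1! ⋯ i_m!)) a_{i_1,…,i_m} b_1^{i_1} ⋯ b_m^{i_m}`. -/
def pairing {K : Type*} [Field K] {m d : ℕ} (a : PerazzoIdx m d → K) (b : Fin m → K) : K :=
  ∑ i : PerazzoIdx m d, (Nat.multinomial Finset.univ i.1 : K) * a i * ∏ k, b k ^ i.1 k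

end

/-! Write `ℓ = L + φ` with `L = ∑ b_k y_k` and `φ = ∑ a_i x_i`. Since `F` is linear in the `X_i`,
all products `x_i x_k` vanish in `A_F`, and the pairing `(w, z) ↦ (wz ∘ F)(0)` exhibits `A_F` as the
truncated ring `B = K[y]/(y)^d` plus the ideal of the `x_i`, which is the dual of `B` as a
`K[y]`-module. If `b k₀ ≠ 0`, then `L` can replace `y_{k₀}` as a variable. Multiplication by `L`
cuts the monomial basis of `B` into strings, one of length `d - e` for each monomial of degree `e <
d` in the other variables. By transposition it cuts the dual basis into strings of the same lengths,
all starting in degree 1 (`isDualStringBasis`).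

As `φ² = 0`, one has `(L + φ)^n = L^n + n φ L^(n-1)`. On the string of length `n` starting at `v`,
the `n`-th power therefore produces `n c_v` times the last element of the dual string of length `d`.
For `v ≠ 1` that string is longer than `n`, and a homogeneous multiple taken from it corrects the
start. For `v = 1` the error is `d c`. If `c = 0`, all lengths persist (`isJordanBasis_of_eq_zero`).
If `c ≠ 0`, then `d ≠ 0` in `K` makes the string of `1` grow to `d + 1` while the dual string of
length `d` shrinks to `d - 1` (`isJordanBasis_of_ne_zero`).

If `b = 0`, then `ℓ² = 0`, and the number of blocks of size 2 is the rank of `×ℓ`, computed from `ℓ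
A_F ≅ A_{ℓ ∘ F}`. -/

noncomputable section

/-! ### Jordan bases and their change under a square-zero perturbation. -/

section JordanBases

variable {K A : Type*} [Field K] [CommRing A] [Algebra K A]

/-- Strings that span an algebra whose dimension is the sum of their lengths form a Jordan
basis. -/
theorem isJordanBasis_of_span_of_sum_eq_finrank {ℓ : A} {ι : Type*} [Fintype ι] {s : ℕ}
    (e : Fin s ≃ ι) (p : ι → ℕ) (z : ι → A) (hp : ∀ k, 0 < p k)
    (hz : ∀ k, ℓ ^ p k * z k = 0)
    (hspan : ∀ S : Submodule K A, (∀ k j, ℓ ^ j * z k ∈ S) → S = ⊤)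
    (hcard : ∑ k, p k = Module.finrank K A) :
    IsJordanBasis K ℓ (p ∘ e) (z ∘ e) := by
  have hs : Submodule.span K
      (Set.range fun q : (Σ k : Fin s, Fin ((p ∘ e) k)) => ℓ ^ (q.2 : ℕ) * (z ∘ e) q.1) = ⊤ := by
    refine hspan _ fun k j => ?_
    by_cases hj : j < p k
    · have hj' : j < (p ∘ e) (e.symm k) := by simpa using hj
      refine Submodule.subset_span ⟨⟨e.symm k, ⟨j, hj'⟩⟩, ?_⟩
      simp
    · rw [show j = (j - p k) + p k by omega, pow_add, mul_assoc, hz, mul_zero]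
      exact Submodule.zero_mem _
  refine ⟨fun k => hp _, fun k => hz _, ?_, hs⟩
  refine linearIndependent_of_top_le_span_of_card_eq_finrank hs.ge ?_
  rw [← hcard, Fintype.card_sigma, ← e.sum_comp]
  simp

/-- As a sum of singletons, the multiset of string data can be evaluated by counting strings of each
degree, as in `sum_strings`. -/
theorem map_univ_eq_sum_singleton {ι M : Type*} [Fintype ι] {s : ℕ} (e : Fin s ≃ ι) (f : ι → M) :
    (Finset.univ.val.map fun k => f (e k)) = ∑ k, ({f k} : Multiset M) := by
  rw [← e.sum_comp]
  exact ((congrArg Multiset.sum (Multiset.map_map (fun a : M => ({a} : Multiset M))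
    (fun k => f (e k)) Finset.univ.val)).symm.trans (Multiset.sum_map_singleton _)).symm

theorem IsJordanDegreeType.isJordanType {σ : Type*} {G : DPSpace σ K} {ℓ : MacaulayAlg G}
    {S : Multiset (ℕ × ℕ)} (h : IsJordanDegreeType G ℓ S) :
    IsJordanType K ℓ (S.map Prod.fst) := by
  obtain ⟨s, p, ν, z, hb, -, rfl⟩ := h
  exact ⟨s, p, z, hb, by simp [Function.comp_def]⟩

theorem le_of_basis_mem {ι V : Type*} [AddCommGroup V] [Module K V] {C S : Submodule K V}
    (b : Module.Basis ι K C) (h : ∀ i, (b i : V) ∈ S) : C ≤ S := by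
  have h1 : (⊤ : Submodule K C) ≤ S.comap C.subtype := by
    rw [← b.span_eq, Submodule.span_le]
    rintro _ ⟨i, rfl⟩
    exact h i
  exact fun c hc => h1 (Submodule.mem_top (x := (⟨c, hc⟩ : C)))

/-- The Jordan type of multiplication by an element of square zero. -/
theorem isJordanType_of_sq_eq_zero [Module.Finite K A] {ℓ : A} (hℓ : ℓ * ℓ = 0) :
    ∃ t : ℕ, 2 * Module.finrank K (LinearMap.range (LinearMap.mulLeft K ℓ)) + t =
        Module.finrank K A ∧
      IsJordanType K ℓ (Multiset.replicate
        (Module.finrank K (LinearMap.range (LinearMap.mulLeft K ℓ))) 2 +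
        Multiset.replicate t 1) := by
  set T := LinearMap.mulLeft K ℓ with hT
  set r := Module.finrank K (LinearMap.range T) with hr
  have hle : LinearMap.range T ≤ LinearMap.ker T := by
    rintro _ ⟨a, rfl⟩
    simp [hT, ← mul_assoc, hℓ]
  -- A basis of `C` starts the strings of length 2, whose second elements span the image; a basis of
  -- `E`, a complement of the image in the kernel, gives the strings of length 1.
  obtain ⟨C, hC⟩ := (LinearMap.ker T).exists_isCompl
  obtain ⟨E, hE, hE'⟩ := IsModularLattice.exists_disjoint_and_sup_eq hle
  have hrank := T.finrank_range_add_finrank_ker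
  have hCr : Module.finrank K C = r := by
    have := Submodule.finrank_add_eq_of_isCompl hC
    omega
  have hEr : Module.finrank K (LinearMap.ker T) = r + Module.finrank K E := by
    have := Submodule.finrank_sup_add_finrank_inf_eq (LinearMap.range T) E
    rw [hE', hE.eq_bot, finrank_bot] at this
    omega
  set t := Module.finrank K E with ht
  refine ⟨t, by omega, ?_⟩
  let bC := Module.finBasisOfFinrankEq K C hCr
  let bE := Module.finBasis K E
  have key := isJordanBasis_of_span_of_sum_eq_finrank (K := K) (ℓ := ℓ)
    (finSumFinEquiv (m := r) (n := t)).symm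
    (Sum.elim (fun _ => 2) (fun _ => 1)) (Sum.elim (fun k => (bC k : A)) (fun k => (bE k : A)))
    (by rintro (k | k) <;> simp)
    (by
      rintro (k | k)
      · simp [pow_two, hℓ]
      · have : (bE k : A) ∈ LinearMap.ker T := hE' ▸ (le_sup_right : E ≤ _) (bE k).2
        simpa [hT] using this)
    (by
      intro S hS
      have h1 : C ≤ S := le_of_basis_mem bC fun i => by simpa using hS (Sum.inl i) 0
      have h2 : E ≤ S := le_of_basis_mem bE fun i => by simpa using hS (Sum.inr i) 0
      have h3 : C.map T ≤ S := Submodule.map_le_iff_le_comap.2 <|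
        le_of_basis_mem bC fun i => by simpa [hT] using hS (Sum.inl i) 1
      have h4 : LinearMap.range T ≤ S := by
        refine le_trans ?_ h3
        rw [LinearMap.range_eq_map, ← hC.sup_eq_top, Submodule.map_sup,
          (LinearMap.le_ker_iff_map (p := LinearMap.ker T)).1 le_rfl, bot_sup_eq]
      rw [eq_top_iff, ← hC.sup_eq_top, ← hE']
      exact sup_le (sup_le h4 h2) h1)
    (by simp; omega)
  refine ⟨_, _, _, key, ?_⟩
  rw [Function.comp_def, map_univ_eq_sum_singleton]
  simp [Multiset.nsmul_singleton]

/-- Data for the computation of the Jordan basis of `×(L + φ)`: two families of strings of `×L`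
of the same lengths that together form a basis, and a square zero perturbation `φ` that annihilates
the second family and maps into its span. -/
structure IsDualStringBasis (K : Type*) {A : Type*} [Field K] [CommRing A] [Algebra K A]
    (L φ : A) {N : Type*} [Fintype N] (len : N → ℕ) (top : N) (E D : N → A) (c : N → K) : Prop where
  len_pos : ∀ v, 0 < len v
  len_lt : ∀ v, v ≠ top → len v < len top
  perturbation_sq : φ * φ = 0
  perturbation_mul_dual : ∀ v, φ * D v = 0
  pow_mul : ∀ v, L ^ len v * E v = 0
  pow_mul_dual : ∀ v, L ^ len v * D v = 0
  perturbation_mul : ∀ v,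
    φ * (L ^ (len v - 1) * E v) = c v • (L ^ (len top - 1) * D top)
  perturbation_mem : ∀ S : Submodule K A, (∀ v j, L ^ j * D v ∈ S) → ∀ a, φ * a ∈ S
  span : ∀ S : Submodule K A, (∀ v j, L ^ j * E v ∈ S) → (∀ v j, L ^ j * D v ∈ S) → S = ⊤
  finrank_eq : ∑ v, 2 * len v = Module.finrank K A

namespace IsDualStringBasis

variable {L φ : A} {N : Type*} [Fintype N] {len : N → ℕ} {top : N} {E D : N → A} {c : N → K}

theorem add_pow_succ_of_sq_eq_zero (h : φ * φ = 0) (k : ℕ) :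
    (L + φ) ^ (k + 1) = L ^ (k + 1) + ((k + 1 : ℕ) : A) * (φ * L ^ k) := by
  induction k with
  | zero => simp
  | succ k ih =>
    rw [pow_succ, ih]
    push_cast
    linear_combination ((k : A) + 1) * L ^ k * h

theorem exists_add_pow_eq (L φ : A) (k : ℕ) : ∃ r, (L + φ) ^ k = L ^ k + φ * r := by
  obtain ⟨r, hr⟩ := sub_dvd_pow_sub_pow (L + φ) L k
  exact ⟨r, by linear_combination hr⟩

theorem add_pow_mul_dual (h : IsDualStringBasis K L φ len top E D c) (v : N) (k : ℕ) :
    (L + φ) ^ k * D v = L ^ k * D v := by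
  obtain ⟨r, hr⟩ := exists_add_pow_eq L φ k
  rw [hr]
  linear_combination r * h.perturbation_mul_dual v

/-- The term `L ^ len v` kills `E v`, so only the part linear in `φ` survives. -/
theorem add_pow_len_mul (h : IsDualStringBasis K L φ len top E D c) (v : N) :
    (L + φ) ^ len v * E v = ((len v : K) * c v) • (L ^ (len top - 1) * D top) := by
  obtain ⟨k, hk⟩ := Nat.exists_eq_add_of_lt (h.len_pos v)
  have h1 := h.pow_mul v
  have h2 := h.perturbation_mul v
  rw [show len v = k + 1 by omega] at h1 h2 ⊢
  rw [add_pow_succ_of_sq_eq_zero h.perturbation_sq, add_mul, h1, zero_add, mul_smul, ← h2,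
    Algebra.smul_def, map_natCast, Nat.add_sub_cancel, mul_assoc, mul_assoc]

/-- The start of the string of `×(L + φ)` that corresponds to the string `E v` of `×L`. -/
def start (L : A) (len : N → ℕ) (top : N) (E D : N → A) (c : N → K) (v : N) : A :=
  E v - ((len v : K) * c v) • (L ^ (len top - 1 - len v) * D top)

/-- The exponent in `start` is chosen so that `len v` further steps carry the correction to the end
of the top dual string, where it cancels the error. This needs `len v < len top`; for `v = top` the
coefficient has to vanish instead. -/
theorem add_pow_len_mul_start (h : IsDualStringBasis K L φ len top E D c) {v : N}
    (hv : v ≠ top ∨ c v = 0) : (L + φ) ^ len v * start L len top E D c v = 0 := by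
  rw [start, mul_sub, h.add_pow_len_mul, mul_smul_comm]
  rcases hv with hv | hv
  · have := h.len_lt v hv
    rw [mul_left_comm, h.add_pow_mul_dual, ← mul_assoc, ← pow_add,
      show len top - 1 - len v + len v = len top - 1 by omega, sub_self]
  · simp [hv]

/-- Modulo the span of the dual strings, `φ` acts as zero and `start` agrees with `E v`. -/
theorem mem_of_add_pow_mul_start_mem (h : IsDualStringBasis K L φ len top E D c)
    {S : Submodule K A} (hS : ∀ v j, L ^ j * D v ∈ S) (v : N) (j : ℕ)
    (hv : (L + φ) ^ j * start L len top E D c v ∈ S) : L ^ j * E v ∈ S := by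
  obtain ⟨r, hr⟩ := exists_add_pow_eq L φ j
  have h1 : L ^ j * E v = (L + φ) ^ j * start L len top E D c v - φ * (r * E v) +
      ((len v : K) * c v) • (L ^ (len top - 1 - len v + j) * D top) := by
    rw [start, mul_sub, mul_smul_comm, mul_left_comm, h.add_pow_mul_dual, hr, ← mul_assoc,
      ← pow_add]
    ring
  rw [h1]
  exact S.add_mem (S.sub_mem hv (h.perturbation_mem S hS _)) (S.smul_mem _ (hS _ _))

theorem isJordanBasis_of_eq_zero (h : IsDualStringBasis K L φ len top E D c) (hc : c top = 0)
    {s : ℕ} (e : Fin s ≃ N ⊕ N) :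
    IsJordanBasis K (L + φ) (Sum.elim len len ∘ e)
      (Sum.elim (start L len top E D c) D ∘ e) := by
  refine isJordanBasis_of_span_of_sum_eq_finrank e _ _ ?_ ?_ ?_ ?_
  · rintro (v | v) <;> exact h.len_pos v
  · rintro (v | v)
    · refine h.add_pow_len_mul_start ?_
      by_cases hv : v = top
      · exact Or.inr (hv ▸ hc)
      · exact Or.inl hv
    · simp [h.add_pow_mul_dual, h.pow_mul_dual]
  · intro S hS
    have hD : ∀ v j, L ^ j * D v ∈ S := fun v j => by
      simpa [h.add_pow_mul_dual] using hS (Sum.inr v) j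
    exact h.span S (fun v j => h.mem_of_add_pow_mul_start_mem hD v j (hS (Sum.inl v) j)) hD
  · simp [← h.finrank_eq, two_mul, Finset.sum_add_distrib]

variable [DecidableEq N]

/-- The string of `E top` now runs on into the last element of the top dual string. The new dual
start is the combination of two elements that `len top - 1` steps carry to the same vector. -/
theorem isJordanBasis_of_ne_zero (h : IsDualStringBasis K L φ len top E D c) (hc : c top ≠ 0)
    (hlen : (len top : K) ≠ 0) (htop : 2 ≤ len top) {s : ℕ} (e : Fin s ≃ N ⊕ N) :
    IsJordanBasis K (L + φ)
      (Sum.elim (Function.update len top (len top + 1)) (Function.update len top (len top - 1)) ∘ e)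
      (Sum.elim (Function.update (start L len top E D c) top (E top))
        (Function.update D top
          ((L + φ) * E top - ((len top : K) * c top) • D top)) ∘ e) := by
  refine isJordanBasis_of_span_of_sum_eq_finrank e _ _ ?_ ?_ ?_ ?_
  · rintro (v | v) <;> by_cases hv : v = top
    · subst hv; simp
    · simpa [hv] using h.len_pos v
    · subst hv; simp; omega
    · simpa [hv] using h.len_pos v
  · rintro (v | v) <;> by_cases hv : v = top
    · subst hv
      simp [pow_succ', mul_assoc, h.add_pow_len_mul, add_mul, h.perturbation_mul_dual,
        mul_left_comm φ]
      right
      rw [← mul_assoc, ← pow_succ', Nat.sub_add_cancel (by omega), h.pow_mul_dual]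
    · simpa [hv] using h.add_pow_len_mul_start (Or.inl hv)
    · subst hv
      have h1 := h.add_pow_len_mul v
      simp only [Sum.elim_inr, Function.update_self]
      rw [mul_sub, ← mul_assoc, ← pow_succ, Nat.sub_add_cancel (by omega), h1, mul_smul_comm,
        h.add_pow_mul_dual, sub_self]
    · simp [hv, h.add_pow_mul_dual, h.pow_mul_dual]
  · intro S hS
    have hE : ∀ j, (L + φ) ^ j * E top ∈ S := fun j => by simpa using hS (Sum.inl top) j
    have hD : ∀ v j, L ^ j * D v ∈ S := fun v j => by
      by_cases hv : v = top
      · subst hv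
        have h1 := hS (Sum.inr v) j
        simp only [Sum.elim_inr, Function.update_self] at h1
        rw [mul_sub, ← mul_assoc, ← pow_succ, mul_smul_comm, h.add_pow_mul_dual] at h1
        -- The difference is `len top * c top` times `L ^ j * D top`, and this scalar is invertible.
        have h2 := S.sub_mem (hE (j + 1)) h1
        rw [sub_sub_cancel] at h2
        exact (S.smul_mem_iff (mul_ne_zero hlen hc)).1 h2
      · simpa [hv, h.add_pow_mul_dual] using hS (Sum.inr v) j
    refine h.span S (fun v j => ?_) hD
    by_cases hv : v = top
    · subst hv
      obtain ⟨r, hr⟩ := exists_add_pow_eq L φ j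
      have h1 : L ^ j * E v = (L + φ) ^ j * E v - φ * (r * E v) := by rw [hr]; ring
      rw [h1]
      exact S.sub_mem (hE j) (h.perturbation_mem S hD _)
    · exact h.mem_of_add_pow_mul_start_mem hD v j (by simpa [hv] using hS (Sum.inl v) j)
  · rw [← h.finrank_eq, Fintype.sum_sum_type, ← Finset.sum_add_distrib]
    refine Finset.sum_congr rfl fun v _ => ?_
    by_cases hv : v = top
    · subst hv; simp; omega
    · simp [hv]; omega

end IsDualStringBasis

end JordanBases

/-! ### The nondegenerate pairing on a Macaulay dual algebra. -/

section MacaulayDuality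

variable {σ K : Type*} [Field K]

theorem contract_monomial_apply (t s : σ →₀ ℕ) (c : K) (G : DPSpace σ K) :
    contract (monomial t c) G s = c * G (s + t) := by
  have : contract (monomial t c) = c • contractMonomial σ K t :=
    AddMonoidAlgebra.lift_single _ _ _
  rw [this]
  simp [contractMonomial, Finsupp.lcomapDomain]

/-- The functional `f ↦ (f ∘ G)(0)` on the polynomial ring. -/
def apolarForm (G : DPSpace σ K) : MvPolynomial σ K →ₗ[K] K where
  toFun f := contract f G 0
  map_add' f g := by simp
  map_smul' c f := by simp

theorem apolarForm_monomial (G : DPSpace σ K) (t : σ →₀ ℕ) (c : K) :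
    apolarForm G (monomial t c) = c * G t := by
  simp [apolarForm, contract_monomial_apply]

theorem mem_annIdeal {G : DPSpace σ K} {f : MvPolynomial σ K} :
    f ∈ annIdeal G ↔ contract f G = 0 := Iff.rfl

/-- The functional on `A_G` induced by `f ↦ (f ∘ G)(0)`. -/
def dualForm (G : DPSpace σ K) : MacaulayAlg G →ₗ[K] K :=
  Submodule.liftQ ((annIdeal G).restrictScalars K) (apolarForm G)
      (fun f hf => by
        have : contract f G = 0 := hf
        simp [apolarForm, this]) ∘ₗ
    (Submodule.Quotient.restrictScalarsEquiv K (annIdeal G)).symm.toLinearMap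

theorem dualForm_mk (G : DPSpace σ K) (f : MvPolynomial σ K) :
    dualForm G (Ideal.Quotient.mk _ f) = apolarForm G f := rfl

/-- The pairing `(w, z) ↦ dualForm (w z)` is nondegenerate. -/
theorem eq_zero_of_dualForm_monomial_mul {G : DPSpace σ K} {z : MacaulayAlg G}
    (h : ∀ t, dualForm G (Ideal.Quotient.mk _ (monomial t 1) * z) = 0) : z = 0 := by
  obtain ⟨f, rfl⟩ := Ideal.Quotient.mk_surjective z
  rw [Ideal.Quotient.eq_zero_iff_mem, mem_annIdeal]
  ext t
  have := h t
  rw [← map_mul, dualForm_mk] at this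
  -- The constant coefficient of `x^t ∘ (f ∘ G)` is the coefficient of `f ∘ G` at `t`.
  have h2 : contract (monomial t (1 : K) * f) G 0 = 0 := this
  rw [map_mul, Module.End.mul_apply, contract_monomial_apply, one_mul, zero_add] at h2
  simpa using h2

theorem mul_mem_gradedPiece {G : DPSpace σ K} {z w : MacaulayAlg G} {i j : ℕ}
    (hz : z ∈ gradedPiece G i) (hw : w ∈ gradedPiece G j) : z * w ∈ gradedPiece G (i + j) := by
  obtain ⟨f, hf, rfl⟩ := hz
  obtain ⟨g, hg, rfl⟩ := hw
  exact ⟨f * g, IsHomogeneous.mul hf hg, by simp⟩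

theorem pow_mem_gradedPiece {G : DPSpace σ K} {z : MacaulayAlg G} {i : ℕ}
    (hz : z ∈ gradedPiece G i) (k : ℕ) : z ^ k ∈ gradedPiece G (i * k) := by
  obtain ⟨f, hf, rfl⟩ := hz
  exact ⟨f ^ k, IsHomogeneous.pow hf k, by simp⟩

/-- `A_{ℓ ∘ F}` is isomorphic to the ideal `ℓ A_F`. -/
theorem finrank_macaulayAlg_contract (G : DPSpace σ K) (f : MvPolynomial σ K) :
    Module.finrank K (MacaulayAlg (contract f G)) =
      Module.finrank K (LinearMap.range (LinearMap.mulLeft K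
        (Ideal.Quotient.mk (annIdeal G) f))) := by
  let T : MvPolynomial σ K →ₗ[K] MacaulayAlg G :=
    LinearMap.mulLeft K (Ideal.Quotient.mk (annIdeal G) f) ∘ₗ
      (Ideal.Quotient.mkₐ K (annIdeal G)).toLinearMap
  -- `g` annihilates `f ∘ G` exactly when `g f` annihilates `G`.
  have hker : LinearMap.ker T = (annIdeal (contract f G)).restrictScalars K := by
    ext g
    simp only [T, LinearMap.mem_ker, LinearMap.comp_apply, AlgHom.toLinearMap_apply,
      Ideal.Quotient.mkₐ_eq_mk, LinearMap.mulLeft_apply, ← map_mul,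
      Ideal.Quotient.eq_zero_iff_mem, mem_annIdeal, Submodule.restrictScalars_mem]
    rw [mul_comm, map_mul, Module.End.mul_apply]
  have hrange : LinearMap.range T = LinearMap.range (LinearMap.mulLeft K
      (Ideal.Quotient.mk (annIdeal G) f)) := by
    refine LinearMap.range_comp_of_range_eq_top _ (LinearMap.range_eq_top.2 ?_)
    exact Ideal.Quotient.mkₐ_surjective K _
  rw [← hrange, ← T.quotKerEquivRange.finrank_eq, hker,
    (Submodule.Quotient.restrictScalarsEquiv K (annIdeal (contract f G))).finrank_eq]

end MacaulayDuality

/-! ### Products and pairings in the full Perazzo algebra. -/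

namespace Perazzo

variable {K : Type*} [Field K] {m d : ℕ}

/-- The exponent vector of the monomial of degree `d - 1` that belongs to a variable `x_i`. -/
def expo (i : PerazzoIdx m d) : Fin m →₀ ℕ := Finsupp.equivFunOnFinite.symm i.1

theorem expo_injective : Function.Injective (expo : PerazzoIdx m d → Fin m →₀ ℕ) :=
  Finsupp.equivFunOnFinite.symm.injective.comp Subtype.val_injective

theorem degree_expo (i : PerazzoIdx m d) : (expo i).degree = d - 1 := by
  rw [Finsupp.degree_eq_sum]
  exact (Finset.mem_piAntidiag.1 i.2).1

theorem exists_expo_eq {u : Fin m →₀ ℕ} (hu : u.degree = d - 1) :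
    ∃ i : PerazzoIdx m d, expo i = u :=
  ⟨⟨u, Finset.mem_piAntidiag.2 ⟨by rw [← hu, Finsupp.degree_eq_sum], by simp⟩⟩,
    by ext; simp [expo]⟩

theorem fullPerazzoForm_eq : fullPerazzoForm K m d =
    ∑ i : PerazzoIdx m d, Finsupp.single
      (Finsupp.single (Sum.inl i) 1 + Finsupp.mapDomain Sum.inr (expo i)) 1 := by
  unfold fullPerazzoForm
  refine Finset.sum_congr rfl fun i _ => ?_
  congr 2
  rw [Finsupp.mapDomain, Finsupp.sum_fintype _ _ (by simp)]
  rfl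

theorem fullPerazzoForm_apply_eq_zero {t : PerazzoVar m d →₀ ℕ}
    (ht : ∑ i, t (Sum.inl i) ≠ 1) : fullPerazzoForm K m d t = 0 := by
  rw [fullPerazzoForm_eq, Finsupp.finsetSum_apply]
  refine Finset.sum_eq_zero fun i _ => ?_
  refine Finsupp.single_eq_of_ne ?_
  rintro rfl
  apply ht
  have : ∀ k, (Finsupp.mapDomain Sum.inr (expo i) : PerazzoVar m d →₀ ℕ) (Sum.inl k) = 0 :=
    fun k => Finsupp.mapDomain_of_notMem_range _ _ (by simp)
  simp [this, Finsupp.single_apply]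

theorem fullPerazzoForm_apply (i : PerazzoIdx m d) (u : Fin m →₀ ℕ) :
    fullPerazzoForm K m d (Finsupp.single (Sum.inl i) 1 + Finsupp.mapDomain Sum.inr u) =
      if u = expo i then 1 else 0 := by
  have h0 : ∀ (v : Fin m →₀ ℕ) (k : PerazzoIdx m d),
      (Finsupp.mapDomain Sum.inr v : PerazzoVar m d →₀ ℕ) (Sum.inl k) = 0 :=
    fun v k => Finsupp.mapDomain_of_notMem_range _ _ (by simp)
  have h1 : ∀ (v : Fin m →₀ ℕ) (k : Fin m),
      (Finsupp.mapDomain Sum.inr v : PerazzoVar m d →₀ ℕ) (Sum.inr k) = v k :=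
    fun v k => Finsupp.mapDomain_apply Sum.inr_injective _ _
  rw [fullPerazzoForm_eq, Finsupp.finsetSum_apply, Finset.sum_eq_single i]
  · rw [Finsupp.single_apply]
    refine if_congr ?_ rfl rfl
    rw [add_right_inj, (Finsupp.mapDomain_injective Sum.inr_injective).eq_iff, eq_comm]
  · intro k _ hk
    refine Finsupp.single_eq_of_ne fun h => hk ?_
    have := DFunLike.congr_fun h (Sum.inl i)
    by_contra hki
    simp [h0, hki] at this
  · simp

variable (K m d) in
/-- The full Perazzo algebra. -/
abbrev Alg : Type _ := MacaulayAlg (fullPerazzoForm K m d)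

/-- The class of the variable `x_i`. -/
def xc (i : PerazzoIdx m d) : Alg K m d := Ideal.Quotient.mk _ (X (Sum.inl i))

variable (K m d) in
/-- The inclusion of the polynomials in `y_1, …, y_m`. -/
def yc : MvPolynomial (Fin m) K →ₐ[K] Alg K m d :=
  (Ideal.Quotient.mkₐ K _).comp (rename Sum.inr)

theorem yc_apply (q : MvPolynomial (Fin m) K) :
    yc K m d q = Ideal.Quotient.mk _ (rename Sum.inr q) := rfl

theorem dualForm_yc (q : MvPolynomial (Fin m) K) :
    dualForm _ (yc K m d q) = 0 := by
  induction q using MvPolynomial.induction_on' with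
  | monomial u c =>
    rw [yc_apply, dualForm_mk, rename_monomial, apolarForm_monomial,
      fullPerazzoForm_apply_eq_zero, mul_zero]
    have : ∀ k, (Finsupp.mapDomain Sum.inr u : PerazzoVar m d →₀ ℕ) (Sum.inl k) = 0 :=
      fun k => Finsupp.mapDomain_of_notMem_range _ _ (by simp)
    simp [this]
  | add p q hp hq => rw [map_add, map_add, hp, hq, add_zero]

/-- Contracting `F` by `x_i` leaves the single monomial `Y^i`, so the pairing with `x_i` reads off
one coefficient. -/
theorem dualForm_yc_mul_xc (q : MvPolynomial (Fin m) K) (i : PerazzoIdx m d) :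
    dualForm _ (yc K m d q * xc i) = coeff (expo i) q := by
  induction q using MvPolynomial.induction_on' with
  | monomial u c =>
    rw [yc_apply, xc, ← map_mul, dualForm_mk, rename_monomial, X, monomial_mul, mul_one,
      apolarForm_monomial, add_comm, fullPerazzoForm_apply, coeff_monomial]
    simp
  | add p q hp hq => rw [map_add, add_mul, map_add, hp, hq, coeff_add]

/-- `F` has degree 1 in the `X_i`, so no multiple of `x_i x_k` pairs nontrivially. -/
theorem xc_mul_xc (i k : PerazzoIdx m d) : (xc i * xc k : Alg K m d) = 0 := by
  refine eq_zero_of_dualForm_monomial_mul fun t => ?_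
  rw [xc, xc, ← map_mul, ← map_mul, dualForm_mk, X, X, monomial_mul, monomial_mul,
    apolarForm_monomial, fullPerazzoForm_apply_eq_zero, mul_zero]
  intro h
  simp [Finset.sum_add_distrib, Finsupp.single_apply] at h

theorem monomial_eq_or (t : PerazzoVar m d →₀ ℕ) :
    (∃ u, (Ideal.Quotient.mk _ (monomial t 1) : Alg K m d) = yc K m d (monomial u 1)) ∨
      ∃ i w, (Ideal.Quotient.mk _ (monomial t 1) : Alg K m d) = w * xc i := by
  by_cases h : ∃ i, t (Sum.inl i) ≠ 0
  · obtain ⟨i, hi⟩ := h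
    refine Or.inr ⟨i, Ideal.Quotient.mk _ (monomial (t - Finsupp.single (Sum.inl i) 1) 1), ?_⟩
    rw [xc, X, ← map_mul, monomial_mul, mul_one, tsub_add_cancel_of_le]
    exact Finsupp.single_le_iff.2 (Nat.one_le_iff_ne_zero.2 hi)
  · push Not at h
    refine Or.inl ⟨t.comapDomain Sum.inr Sum.inr_injective.injOn, ?_⟩
    rw [yc_apply, rename_monomial, Finsupp.mapDomain_comapDomain _ Sum.inr_injective]
    rintro (i | k) hi
    · exact absurd (h i) (by simpa using hi)
    · simp

/-- An element that is annihilated by the `x_i` is determined by its pairings with the polynomials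
in the `y_k`. -/
theorem eq_zero_of_xc_mul {z : Alg K m d} (hx : ∀ i, xc i * z = 0)
    (hy : ∀ q, dualForm _ (yc K m d q * z) = 0) : z = 0 := by
  refine eq_zero_of_dualForm_monomial_mul fun t => ?_
  rcases monomial_eq_or (K := K) t with ⟨u, hu⟩ | ⟨i, w, hw⟩
  · rw [hu, hy]
  · rw [hw, mul_assoc, hx, mul_zero, map_zero]

/-- `F` has degree `d - 1` in the `Y_k`. The vanishing criterion is applied twice: to `yc p`, then
to each `x_i * yc p`, whose pairings are coefficients in degree `d - 1` of multiples of `p`. -/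
theorem yc_eq_zero {p : MvPolynomial (Fin m) K} {k : ℕ} (hp : p.IsHomogeneous k) (hk : d ≤ k)
    (hd : 0 < d) : yc K m d p = 0 := by
  refine eq_zero_of_xc_mul (fun i => ?_) fun q => by rw [← map_mul, dualForm_yc]
  refine eq_zero_of_xc_mul (fun k => by rw [← mul_assoc, xc_mul_xc, zero_mul]) fun q => ?_
  rw [mul_comm (xc i), ← mul_assoc, ← map_mul, dualForm_yc_mul_xc]
  induction q using MvPolynomial.induction_on' with
  | monomial u c =>
    refine ((isHomogeneous_monomial c rfl).mul hp).coeff_eq_zero ?_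
    rw [degree_expo]
    omega
  | add q r hq hr => rw [add_mul, coeff_add, hq, hr, add_zero]

theorem yc_mem_gradedPiece {p : MvPolynomial (Fin m) K} {k : ℕ} (hp : p.IsHomogeneous k) :
    yc K m d p ∈ gradedPiece (fullPerazzoForm K m d) k :=
  ⟨rename Sum.inr p, hp.rename_isHomogeneous, rfl⟩

theorem xc_mem_gradedPiece (i : PerazzoIdx m d) :
    xc i ∈ gradedPiece (fullPerazzoForm K m d) 1 :=
  ⟨X (Sum.inl i), isHomogeneous_X _ _, rfl⟩

/-! ### The linear change of variables that makes `L` a variable. -/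

/-- The linear form `∑ b_k y_k`. -/
def yForm (b : Fin m → K) : MvPolynomial (Fin m) K := ∑ k, C (b k) * X k

theorem isHomogeneous_yForm (b : Fin m → K) : (yForm b).IsHomogeneous 1 :=
  IsHomogeneous.sum _ _ _ fun k _ => by
    simpa using (isHomogeneous_C (Fin m) (b k)).mul (isHomogeneous_X K k)

/-- The linear substitution `y_{k₀} ↦ ∑ b_k y_k`. -/
def subst (b : Fin m → K) (k₀ : Fin m) : MvPolynomial (Fin m) K →ₐ[K] MvPolynomial (Fin m) K :=
  aeval fun k => if k = k₀ then yForm b else X k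

/-- The inverse of the linear substitution `y_{k₀} ↦ ∑ b_k y_k`. -/
def substInv (b : Fin m → K) (k₀ : Fin m) :
    MvPolynomial (Fin m) K →ₐ[K] MvPolynomial (Fin m) K :=
  aeval fun k => if k = k₀ then
    C (b k₀)⁻¹ * (X k₀ - ∑ k ∈ Finset.univ.erase k₀, C (b k) * X k) else X k

theorem yForm_eq (b : Fin m → K) (k₀ : Fin m) :
    yForm b = C (b k₀) * X k₀ + ∑ k ∈ Finset.univ.erase k₀, C (b k) * X k :=
  (Finset.add_sum_erase _ _ (Finset.mem_univ _)).symm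

variable {b : Fin m → K} {k₀ : Fin m}

theorem subst_X_self : subst b k₀ (X k₀) = yForm b := by simp [subst]

theorem sum_erase_map (f : MvPolynomial (Fin m) K →ₐ[K] MvPolynomial (Fin m) K)
    (hf : ∀ k ≠ k₀, f (X k) = X k) :
    f (∑ k ∈ Finset.univ.erase k₀, C (b k) * X k) =
      ∑ k ∈ Finset.univ.erase k₀, C (b k) * X k := by
  rw [map_sum]
  refine Finset.sum_congr rfl fun k hk => ?_
  rw [map_mul, hf k (Finset.ne_of_mem_erase hk), algHom_C, algebraMap_eq]

theorem substInv_subst (hb : b k₀ ≠ 0) (q : MvPolynomial (Fin m) K) :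
    substInv b k₀ (subst b k₀ q) = q := by
  have : (substInv b k₀).comp (subst b k₀) = AlgHom.id K _ := by
    refine algHom_ext fun k => ?_
    by_cases hk : k = k₀
    · subst hk
      rw [AlgHom.comp_apply, subst_X_self, yForm_eq b k, map_add, map_mul, algHom_C, algebraMap_eq,
        sum_erase_map _ fun k hk => by simp [substInv, hk]]
      simp only [substInv, aeval_X, if_true, AlgHom.id_apply]
      rw [← mul_assoc, ← C_mul, mul_inv_cancel₀ hb, C_1, one_mul, sub_add_cancel]
    · simp [subst, substInv, hk]
  exact DFunLike.congr_fun this q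

theorem subst_substInv (hb : b k₀ ≠ 0) (q : MvPolynomial (Fin m) K) :
    subst b k₀ (substInv b k₀ q) = q := by
  have : (subst b k₀).comp (substInv b k₀) = AlgHom.id K _ := by
    refine algHom_ext fun k => ?_
    by_cases hk : k = k₀
    · subst hk
      have h1 : substInv b k (X k) =
          C (b k)⁻¹ * (X k - ∑ k ∈ Finset.univ.erase k, C (b k) * X k) := by simp [substInv]
      rw [AlgHom.comp_apply, h1, map_mul, map_sub, algHom_C, algebraMap_eq, subst_X_self,
        sum_erase_map _ fun k hk => by simp [subst, hk], yForm_eq b k, add_sub_cancel_right,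
        ← mul_assoc, ← C_mul, inv_mul_cancel₀ hb, C_1, one_mul, AlgHom.id_apply]
    · simp [subst, substInv, hk]
  exact DFunLike.congr_fun this q

theorem isHomogeneous_subst {q : MvPolynomial (Fin m) K} {k : ℕ} (hq : q.IsHomogeneous k) :
    (subst b k₀ q).IsHomogeneous k := by
  rw [← one_mul k]
  refine hq.aeval _ fun i => ?_
  split_ifs
  exacts [isHomogeneous_yForm b, isHomogeneous_X _ _]

theorem isHomogeneous_substInv {q : MvPolynomial (Fin m) K} {k : ℕ} (hq : q.IsHomogeneous k) :
    (substInv b k₀ q).IsHomogeneous k := by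
  rw [← one_mul k]
  refine hq.aeval _ fun i => ?_
  split_ifs
  · rw [← zero_add 1]
    refine (isHomogeneous_C _ _).mul ((isHomogeneous_X _ _).sub ?_)
    exact IsHomogeneous.sum _ _ _ fun k _ => by
      simpa using (isHomogeneous_C (Fin m) (b k)).mul (isHomogeneous_X K k)
  · exact isHomogeneous_X _ _

theorem coeff_substInv_eq_zero {u w : Fin m →₀ ℕ} (h : u.degree ≠ w.degree) (c : K) :
    coeff u (substInv b k₀ (monomial w c)) = 0 :=
  (isHomogeneous_substInv (isHomogeneous_monomial c rfl)).coeff_eq_zero h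

/-! ### Dual bases of the `y`-part and of the ideal of the `x_i`. -/

/-- The class of the monomial `y^u` after the substitution. -/
def yMon (d : ℕ) (b : Fin m → K) (k₀ : Fin m) (u : Fin m →₀ ℕ) : Alg K m d :=
  yc K m d (subst b k₀ (monomial u 1))

/-- The dual element of `yMon`, a combination of multiples of the `x_i`. -/
def dualMon (d : ℕ) (b : Fin m → K) (k₀ : Fin m) (u : Fin m →₀ ℕ) : Alg K m d :=
  ∑ i, coeff u (substInv b k₀ (monomial (expo i - Finsupp.single k₀ (d - 1 - u.degree)) 1)) •
    (yc K m d (monomial (Finsupp.single k₀ (d - 1 - u.degree)) 1) * xc i)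

theorem yMon_mem_gradedPiece (u : Fin m →₀ ℕ) :
    yMon d b k₀ u ∈ gradedPiece (fullPerazzoForm K m d) u.degree :=
  yc_mem_gradedPiece (isHomogeneous_subst (isHomogeneous_monomial _ rfl))

theorem dualMon_mem_gradedPiece {u : Fin m →₀ ℕ} (hu : u.degree < d) :
    dualMon d b k₀ u ∈ gradedPiece (fullPerazzoForm K m d) (d - u.degree) := by
  refine Submodule.sum_mem _ fun i _ => Submodule.smul_mem _ _ ?_
  rw [show d - u.degree = (d - 1 - u.degree) + 1 by omega]
  exact mul_mem_gradedPiece (yc_mem_gradedPiece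
    (isHomogeneous_monomial _ (Finsupp.degree_single _ _)))
    (xc_mem_gradedPiece i)

theorem xc_mul_dualMon (i : PerazzoIdx m d) (u : Fin m →₀ ℕ) :
    xc i * dualMon d b k₀ u = 0 := by
  rw [dualMon, Finset.mul_sum]
  refine Finset.sum_eq_zero fun k _ => ?_
  rw [mul_smul_comm, mul_left_comm, xc_mul_xc, mul_zero, smul_zero]

/-- The auxiliary factor `y^s`, of degree `d - 1 - u.degree`, lifts monomials of degree `u.degree`
to the degree of the `expo i`. Then `y^w` meets the `i`-th summand exactly when `w + s = expo i`,
that is, when the coefficient stored there belongs to `y^w`. Summands with `s` not below `expo i`,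
where the subtraction truncates, contribute nothing. -/
theorem dualForm_yc_mul_dualMon (q : MvPolynomial (Fin m) K) {u : Fin m →₀ ℕ}
    (hu : u.degree < d) :
    dualForm _ (yc K m d q * dualMon d b k₀ u) = coeff u (substInv b k₀ q) := by
  induction q using MvPolynomial.induction_on' with
  | monomial w c =>
    set s := Finsupp.single k₀ (d - 1 - u.degree) with hs
    have hsd : s.degree = d - 1 - u.degree := Finsupp.degree_single _ _
    have h1 : ∀ i : PerazzoIdx m d, dualForm _ (yc K m d (monomial w c) *
        (coeff u (substInv b k₀ (monomial (expo i - s) 1)) • (yc K m d (monomial s 1) * xc i))) =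
        if w + s = expo i then coeff u (substInv b k₀ (monomial w c)) else 0 := by
      intro i
      rw [mul_smul_comm, map_smul, ← mul_assoc, ← map_mul, dualForm_yc_mul_xc, monomial_mul,
        coeff_monomial]
      split_ifs with h
      · rw [← h, add_tsub_cancel_right, ← mul_one c, ← smul_eq_mul c, ← smul_monomial, map_smul,
          coeff_smul]
        simp [mul_comm]
      · simp
    rw [dualMon, Finset.mul_sum, map_sum, Finset.sum_congr rfl fun i _ => h1 i]
    -- If the degrees differ, the right-hand side vanishes by homogeneity, and so does every
    -- summand.
    by_cases hw : u.degree = w.degree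
    · obtain ⟨i, hi⟩ := exists_expo_eq (d := d) (u := w + s) (by rw [map_add, hsd]; omega)
      rw [Finset.sum_eq_single i, if_pos hi.symm]
      · intro k _ hk
        rw [if_neg]
        rw [← hi]
        exact fun h => hk (expo_injective h).symm
      · simp
    · simp [coeff_substInv_eq_zero hw]
  | add p q hp hq => rw [map_add, add_mul, map_add, hp, hq, map_add, coeff_add]

theorem dualMon_mul_dualMon (u v : Fin m →₀ ℕ) :
    dualMon d b k₀ u * dualMon d b k₀ v = 0 := by
  conv_lhs => enter [1]; rw [dualMon]
  rw [Finset.sum_mul]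
  refine Finset.sum_eq_zero fun i _ => ?_
  rw [smul_mul_assoc, mul_assoc, xc_mul_dualMon, mul_zero, smul_zero]

theorem dualForm_yMon_mul_yMon (u v : Fin m →₀ ℕ) :
    dualForm _ (yMon d b k₀ u * yMon d b k₀ v) = 0 := by
  rw [yMon, yMon, ← map_mul, dualForm_yc]

theorem dualForm_yMon_mul_dualMon (hb : b k₀ ≠ 0) {u : Fin m →₀ ℕ} (hu : u.degree < d)
    (v : Fin m →₀ ℕ) :
    dualForm _ (yMon d b k₀ v * dualMon d b k₀ u) = if v = u then 1 else 0 := by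
  rw [yMon, dualForm_yc_mul_dualMon _ hu, substInv_subst hb, coeff_monomial]

theorem yMon_eq_zero {u : Fin m →₀ ℕ} (hu : d ≤ u.degree) (hd : 0 < d) :
    yMon d b k₀ u = 0 :=
  yc_eq_zero (isHomogeneous_subst (isHomogeneous_monomial _ rfl)) hu hd

theorem yForm_pow_mul_yMon (u : Fin m →₀ ℕ) (j : ℕ) :
    yc K m d (yForm b) ^ j * yMon d b k₀ u = yMon d b k₀ (u + Finsupp.single k₀ j) := by
  rw [yMon, yMon, ← subst_X_self (k₀ := k₀), ← map_pow, ← map_pow, ← map_mul, ← map_mul,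
    X_pow_eq_monomial, monomial_mul, one_mul, add_comm]

theorem substInv_yForm (hb : b k₀ ≠ 0) : substInv b k₀ (yForm b) = X k₀ := by
  rw [← subst_X_self (k₀ := k₀), substInv_subst hb]

/-- Multiplication by `L` is self-adjoint for the pairing. It raises the exponent of `y_{k₀}` on the
monomials, hence lowers it on the dual basis. -/
theorem yForm_pow_mul_dualMon (hb : b k₀ ≠ 0) (u : Fin m →₀ ℕ) (j : ℕ)
    (hu : (u + Finsupp.single k₀ j).degree < d) :
    yc K m d (yForm b) ^ j * dualMon d b k₀ (u + Finsupp.single k₀ j) = dualMon d b k₀ u := by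
  have hu' : u.degree < d := by rw [map_add] at hu; omega
  rw [← sub_eq_zero]
  refine eq_zero_of_xc_mul (fun i => ?_) fun q => ?_
  · rw [mul_sub, mul_left_comm, xc_mul_dualMon, xc_mul_dualMon, mul_zero, sub_zero]
  · rw [mul_sub, ← mul_assoc, ← map_pow, ← map_mul, map_sub, dualForm_yc_mul_dualMon _ hu,
      dualForm_yc_mul_dualMon _ hu', map_mul, map_pow, substInv_yForm hb, X_pow_eq_monomial,
      coeff_mul_monomial, mul_one, sub_self]

theorem yForm_pow_mul_dualMon_eq_zero (hb : b k₀ ≠ 0) {u : Fin m →₀ ℕ} {j : ℕ} (hj : u k₀ < j)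
    (hu : u.degree < d) :
    yc K m d (yForm b) ^ j * dualMon d b k₀ u = 0 := by
  refine eq_zero_of_xc_mul (fun i => ?_) fun q => ?_
  · rw [mul_left_comm, xc_mul_dualMon, mul_zero]
  · rw [← mul_assoc, ← map_pow, ← map_mul, dualForm_yc_mul_dualMon _ hu, map_mul, map_pow,
      substInv_yForm hb, X_pow_eq_monomial, coeff_mul_monomial', if_neg]
    rw [Finsupp.single_le_iff]
    omega

/-- The exponent vectors of degree less than `d`. -/
def smallExpos (m d : ℕ) : Finset (Fin m →₀ ℕ) :=
  (Finset.range d).biUnion fun e => Finset.univ.finsuppAntidiag e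

theorem mem_smallExpos {u : Fin m →₀ ℕ} : u ∈ smallExpos m d ↔ u.degree < d := by
  simp [smallExpos, Finsupp.degree_eq_sum]

/-- An element killed by all `x_i` is expanded in the dual basis, its coefficients being the
pairings with the `yMon`. -/
theorem mem_of_xc_mul_eq_zero (hb : b k₀ ≠ 0) (hd : 0 < d) {S : Submodule K (Alg K m d)}
    (hS : ∀ u : Fin m →₀ ℕ, u.degree < d → dualMon d b k₀ u ∈ S) {z : Alg K m d}
    (hz : ∀ i, xc i * z = 0) : z ∈ S := by
  have : z = ∑ u ∈ smallExpos m d, dualForm _ (yMon d b k₀ u * z) • dualMon d b k₀ u := by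
    rw [← sub_eq_zero]
    refine eq_zero_of_xc_mul (fun i => ?_) fun q => ?_
    · rw [mul_sub, hz, zero_sub, neg_eq_zero, Finset.mul_sum]
      exact Finset.sum_eq_zero fun u _ => by rw [mul_smul_comm, xc_mul_dualMon, smul_zero]
    · rw [← subst_substInv hb q]
      generalize substInv b k₀ q = q
      induction q using MvPolynomial.induction_on' with
      | monomial w c =>
        rw [← mul_one c, ← smul_eq_mul c, ← smul_monomial, map_smul, map_smul, smul_mul_assoc,
          map_smul, ← yMon, mul_sub, Finset.mul_sum, map_sub, map_sum]
        simp only [mul_smul_comm, map_smul]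
        rw [Finset.sum_congr rfl fun u hu => by
          rw [dualForm_yMon_mul_dualMon hb (mem_smallExpos.1 hu)]]
        by_cases hw : w.degree < d
        · simp [mem_smallExpos, hw]
        · simp [mem_smallExpos, hw, yMon_eq_zero (not_lt.1 hw) hd]
      | add p q hp hq => rw [map_add, map_add, add_mul, map_add, hp, hq, add_zero]
  rw [this]
  exact S.sum_mem fun u hu => S.smul_mem _ (hS u (mem_smallExpos.1 hu))

theorem eq_top_of_mem (hb : b k₀ ≠ 0) (hd : 0 < d) {S : Submodule K (Alg K m d)}
    (hE : ∀ u : Fin m →₀ ℕ, u.degree < d → yMon d b k₀ u ∈ S)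
    (hD : ∀ u : Fin m →₀ ℕ, u.degree < d → dualMon d b k₀ u ∈ S) : S = ⊤ := by
  refine eq_top_iff.2 fun z _ => ?_
  obtain ⟨f, rfl⟩ := Ideal.Quotient.mk_surjective z
  induction f using MvPolynomial.induction_on' with
  | monomial t c =>
    have : (Ideal.Quotient.mk _ (monomial t c) : Alg K m d) =
        c • Ideal.Quotient.mk _ (monomial t 1) := by
      rw [← mul_one c, ← smul_eq_mul c, ← smul_monomial]
      simp
      rfl
    rw [this]
    refine S.smul_mem _ ?_
    rcases monomial_eq_or (K := K) t with ⟨u, hu⟩ | ⟨i, w, hw⟩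
    · rw [hu, ← subst_substInv hb (monomial u 1)]
      generalize substInv b k₀ _ = q
      induction q using MvPolynomial.induction_on' with
      | monomial w c =>
        rw [← mul_one c, ← smul_eq_mul c, ← smul_monomial, map_smul, map_smul]
        refine S.smul_mem _ ?_
        by_cases hw : w.degree < d
        · exact hE w hw
        · have := yMon_eq_zero (b := b) (k₀ := k₀) (not_lt.1 hw) hd
          rw [yMon] at this
          rw [this]
          exact S.zero_mem
      | add p q hp hq =>
        rw [map_add, map_add]
        exact S.add_mem hp hq
    · rw [hw]
      exact mem_of_xc_mul_eq_zero hb hd hD fun k => by rw [mul_left_comm, xc_mul_xc, mul_zero]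
  | add p q hp hq =>
    rw [map_add]
    exact S.add_mem (hp trivial) (hq trivial)

/-! ### The strings of multiplication by `L`. -/

/-- The exponent vectors of degree less than `d` of the monomials without `y_{k₀}`. -/
def strings (d : ℕ) (k₀ : Fin m) : Finset (Fin m →₀ ℕ) :=
  (Finset.range d).biUnion fun e => (Finset.univ.erase k₀).finsuppAntidiag e

theorem mem_finsuppAntidiag_erase {v : Fin m →₀ ℕ} {e : ℕ} :
    v ∈ (Finset.univ.erase k₀).finsuppAntidiag e ↔ v k₀ = 0 ∧ v.degree = e := by
  have h : v.support ⊆ Finset.univ.erase k₀ ↔ v k₀ = 0 := by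
    constructor
    · intro h
      by_contra h0
      exact absurd (h (Finsupp.mem_support_iff.2 h0)) (by simp)
    · intro h k hk
      refine Finset.mem_erase.2 ⟨?_, Finset.mem_univ _⟩
      rintro rfl
      exact Finsupp.mem_support_iff.1 hk h
  rw [Finset.mem_finsuppAntidiag, h, and_comm, Finsupp.degree_eq_sum]
  refine and_congr_right fun h0 => ?_
  rw [← Finset.add_sum_erase _ _ (Finset.mem_univ k₀), h0, zero_add]

theorem mem_strings {v : Fin m →₀ ℕ} : v ∈ strings d k₀ ↔ v k₀ = 0 ∧ v.degree < d := by
  simp only [strings, Finset.mem_biUnion, Finset.mem_range, mem_finsuppAntidiag_erase]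
  constructor
  · rintro ⟨e, he, h0, rfl⟩
    exact ⟨h0, he⟩
  · rintro ⟨h0, h1⟩
    exact ⟨_, h1, h0, rfl⟩

/-- Stars and bars in the `m - 1` variables other than `y_{k₀}`. The target is a general monoid so
that `f` can take multisets as values. -/
theorem sum_strings {M : Type*} [AddCommMonoid M] (f : ℕ → M) :
    ∑ v : strings d k₀, f v.1.degree =
      ∑ e ∈ Finset.range d, ((m - 1 + e - 1).choose e) • f e := by
  rw [Finset.sum_coe_sort (strings d k₀) fun v => f v.degree, strings, Finset.sum_biUnion]
  · refine Finset.sum_congr rfl fun e _ => ?_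
    rw [Finset.sum_congr rfl fun v hv => by rw [(mem_finsuppAntidiag_erase.1 hv).2],
      Finset.sum_const, Finset.card_finsuppAntidiag_nat_eq_choose,
      Finset.card_erase_of_mem (Finset.mem_univ _), Finset.card_univ, Fintype.card_fin]
  · intro e _ e' _ h
    refine Finset.disjoint_left.2 fun v hv hv' => h ?_
    rw [← (mem_finsuppAntidiag_erase.1 hv).2, ← (mem_finsuppAntidiag_erase.1 hv').2]

/-- The length of the string that starts at the monomial `y^v`. -/
def len (v : strings d k₀) : ℕ := d - v.1.degree

theorem degree_lt (v : strings d k₀) : v.1.degree < d := (mem_strings.1 v.2).2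

theorem apply_eq_zero (v : strings d k₀) : v.1 k₀ = 0 := (mem_strings.1 v.2).1

theorem len_pos (v : strings d k₀) : 0 < len v := Nat.sub_pos_of_lt (degree_lt v)

/-- The string of the powers of the linear form. -/
def top (hd : 0 < d) (k₀ : Fin m) : strings d k₀ :=
  ⟨0, mem_strings.2 ⟨rfl, by simpa using hd⟩⟩

theorem len_top (hd : 0 < d) : len (top hd k₀) = d := by simp [len, top]

theorem eq_top_iff_degree (hd : 0 < d) (v : strings d k₀) :
    v = top hd k₀ ↔ v.1.degree = 0 := by
  rw [Finsupp.degree_eq_zero_iff, Subtype.ext_iff]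
  rfl

/-- The position of the `j`-th element of a string. -/
def expoAt (v : strings d k₀) (j : ℕ) : Fin m →₀ ℕ := v.1 + Finsupp.single k₀ j

theorem degree_expoAt (v : strings d k₀) (j : ℕ) : (expoAt v j).degree = v.1.degree + j := by
  rw [expoAt, map_add, Finsupp.degree_single]

theorem exists_expoAt {u : Fin m →₀ ℕ} (hu : u.degree < d) :
    ∃ (v : strings d k₀) (j : ℕ), j < len v ∧ expoAt v j = u := by
  have h := Finsupp.erase_add_single k₀ u
  have h2 : (u.erase k₀).degree + u k₀ = u.degree := by
    conv_rhs => rw [← h]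
    rw [map_add, Finsupp.degree_single]
  exact ⟨⟨u.erase k₀, mem_strings.2 ⟨Finsupp.erase_same, by omega⟩⟩, u k₀,
    by simp only [len]; omega, h⟩

theorem expoAt_injective {v w : strings d k₀} {i j : ℕ} (h : expoAt v i = expoAt w j) :
    v = w ∧ i = j := by
  have h1 := DFunLike.congr_fun h k₀
  simp only [expoAt, Finsupp.add_apply, apply_eq_zero, Finsupp.single_eq_same, zero_add] at h1
  subst h1
  exact ⟨Subtype.ext (add_right_cancel h), rfl⟩

/-- The `yMon` and `dualMon` form a basis: in the pairing each family is isotropic and the two are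
dual to each other, so pairing a relation with one family isolates the coefficients of the other. -/
theorem finrank_alg (hb : b k₀ ≠ 0) (hd : 0 < d) :
    ∑ v : strings d k₀, 2 * len v = Module.finrank K (Alg K m d) := by
  let ι := Σ v : strings d k₀, Fin (len v)
  let u : ι → Fin m →₀ ℕ := fun q => expoAt q.1 q.2
  have hu : ∀ q, (u q).degree < d := fun q => by
    have := q.2.2
    have h2 := degree_expoAt q.1 q.2
    simp only [len] at this
    simp only [u]
    omega
  have huinj : Function.Injective u := by
    rintro ⟨v, i⟩ ⟨w, j⟩ h
    obtain ⟨rfl, h2⟩ := expoAt_injective h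
    exact congrArg (Sigma.mk v) (Fin.ext h2)
  let B : ι ⊕ ι → Alg K m d :=
    Sum.elim (fun q => yMon d b k₀ (u q)) (fun q => dualMon d b k₀ (u q))
  have hli : LinearIndependent K B := by
    rw [Fintype.linearIndependent_iff]
    intro g hg
    rw [Fintype.sum_sum_type] at hg
    simp only [B, Sum.elim_inl, Sum.elim_inr] at hg
    rintro (q | q)
    · have := congrArg (fun z => dualForm _ (z * dualMon d b k₀ (u q))) hg
      simp only [add_mul, Finset.sum_mul, smul_mul_assoc, map_add, map_sum, map_smul,
        dualMon_mul_dualMon, dualForm_yMon_mul_dualMon hb (hu _), huinj.eq_iff] at this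
      simpa using this
    · have := congrArg (fun z => dualForm _ (yMon d b k₀ (u q) * z)) hg
      simp only [mul_add, Finset.mul_sum, mul_smul_comm, map_add, map_sum, map_smul,
        dualForm_yMon_mul_yMon, dualForm_yMon_mul_dualMon hb (hu _), huinj.eq_iff] at this
      simpa using this
  have hspan : Submodule.span K (Set.range B) = ⊤ := by
    refine eq_top_of_mem hb hd (fun w hw => ?_) fun w hw => ?_
    · obtain ⟨v, j, hj, rfl⟩ := exists_expoAt (k₀ := k₀) hw
      exact Submodule.subset_span ⟨Sum.inl ⟨v, ⟨j, hj⟩⟩, rfl⟩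
    · obtain ⟨v, j, hj, rfl⟩ := exists_expoAt (k₀ := k₀) hw
      exact Submodule.subset_span ⟨Sum.inr ⟨v, ⟨j, hj⟩⟩, rfl⟩
  rw [Module.finrank_eq_card_basis (Module.Basis.mk hli hspan.ge), Fintype.card_sum,
    Fintype.card_sigma, ← Finset.mul_sum, two_mul]
  simp

/-! ### The perturbation by the `x`-part. -/

/-- The element `∑ a_i x_i`. -/
def xForm (a : PerazzoIdx m d → K) : Alg K m d := ∑ i, a i • xc i

theorem xc_mul_xForm (a : PerazzoIdx m d → K) (i : PerazzoIdx m d) : xc i * xForm a = 0 := by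
  rw [xForm, Finset.mul_sum]
  exact Finset.sum_eq_zero fun k _ => by rw [mul_smul_comm, xc_mul_xc, smul_zero]

theorem xForm_mul_of_xc_mul {z : Alg K m d} (hz : ∀ i, xc i * z = 0) (a : PerazzoIdx m d → K) :
    xForm a * z = 0 := by
  rw [xForm, Finset.sum_mul]
  exact Finset.sum_eq_zero fun k _ => by rw [smul_mul_assoc, hz, smul_zero]

theorem xForm_mul_self (a : PerazzoIdx m d → K) : xForm a * xForm a = 0 :=
  xForm_mul_of_xc_mul (xc_mul_xForm a) a

/-- The functional `y^i ↦ a_i` on the polynomials in `y_1, …, y_m`. -/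
def evalForm (a : PerazzoIdx m d → K) (q : MvPolynomial (Fin m) K) : K :=
  ∑ i, a i * coeff (expo i) q

theorem dualForm_yc_mul_xForm (a : PerazzoIdx m d → K) (q : MvPolynomial (Fin m) K) :
    dualForm _ (yc K m d q * xForm a) = evalForm a q := by
  rw [xForm, Finset.mul_sum, map_sum]
  exact Finset.sum_congr rfl fun i _ => by
    rw [mul_smul_comm, map_smul, dualForm_yc_mul_xc, smul_eq_mul]

theorem evalForm_eq_zero (a : PerazzoIdx m d → K) {q : MvPolynomial (Fin m) K} {k : ℕ}
    (hq : q.IsHomogeneous k) (hk : k ≠ d - 1) : evalForm a q = 0 :=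
  Finset.sum_eq_zero fun i _ => by
    rw [hq.coeff_eq_zero (by rw [degree_expo]; exact hk.symm), mul_zero]

theorem evalForm_smul (a : PerazzoIdx m d → K) (c : K) (q : MvPolynomial (Fin m) K) :
    evalForm a (c • q) = c * evalForm a q := by
  simp [evalForm, Finset.mul_sum, mul_left_comm]

/-- `dualMon 0` pairs with a polynomial to its constant term. The left side does the same up to the
factor `evalForm a p`, because multiplying `p` by a form of positive degree leaves degree `d - 1`,
where `evalForm a` lives. -/
theorem xForm_mul_yc (hb : b k₀ ≠ 0) (hd : 0 < d) (a : PerazzoIdx m d → K)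
    {p : MvPolynomial (Fin m) K} (hp : p.IsHomogeneous (d - 1)) :
    xForm a * yc K m d p = evalForm a p • dualMon d b k₀ 0 := by
  rw [← sub_eq_zero]
  refine eq_zero_of_xc_mul (fun i => ?_) fun q => ?_
  · rw [mul_sub, ← mul_assoc, xc_mul_xForm, zero_mul, mul_smul_comm, xc_mul_dualMon, smul_zero,
      sub_zero]
  · rw [mul_sub, map_sub, mul_smul_comm, map_smul, dualForm_yc_mul_dualMon q (by simpa using hd),
      mul_left_comm, ← map_mul, mul_comm (xForm a), dualForm_yc_mul_xForm]
    rw [← subst_substInv hb q, substInv_subst hb]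
    generalize substInv b k₀ q = q
    induction q using MvPolynomial.induction_on' with
    | monomial w c =>
      rw [← mul_one c, ← smul_eq_mul c, ← smul_monomial, map_smul, smul_mul_assoc, evalForm_smul,
        coeff_smul, coeff_monomial]
      by_cases hw : w = 0
      · subst hw
        simp [mul_comm]
      · rw [evalForm_eq_zero a ((isHomogeneous_subst (isHomogeneous_monomial 1 rfl)).mul hp),
          if_neg hw]
        · simp
        · have := (Finsupp.degree_eq_zero_iff w).not.2 hw
          omega
    | add p q hp hq =>
      rw [map_add, add_mul]
      have : ∀ p q, evalForm a (p + q) = evalForm a p + evalForm a q := fun p q => by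
        simp [evalForm, mul_add, Finset.sum_add_distrib]
      rw [this, coeff_add, smul_eq_mul, mul_add]
      rw [smul_eq_mul] at hp hq
      linear_combination hp + hq

theorem coeff_yForm_pow (b : Fin m → K) (i : PerazzoIdx m d) :
    coeff (expo i) (yForm b ^ (d - 1)) =
      (Nat.multinomial Finset.univ i.1 : K) * ∏ k, b k ^ i.1 k := by
  have h1 : ∀ f : Fin m → ℕ, ∏ k, (C (b k) * X k : MvPolynomial (Fin m) K) ^ f k =
      monomial (Finsupp.equivFunOnFinite.symm f) (∏ k, b k ^ f k) := by
    intro f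
    rw [monomial_eq, Finsupp.prod_fintype _ _ (by simp)]
    simp [mul_pow, Finset.prod_mul_distrib]
  rw [yForm, Finset.sum_pow_eq_sum_piAntidiag, coeff_sum, Finset.sum_eq_single i.1]
  · rw [h1, ← nsmul_eq_mul, coeff_smul, expo, coeff_monomial, if_pos rfl, nsmul_eq_mul]
  · intro f _ hf
    rw [h1, ← nsmul_eq_mul, coeff_smul, expo, coeff_monomial, if_neg, smul_zero]
    exact fun h => hf (Finsupp.equivFunOnFinite.symm.injective h)
  · exact fun h => absurd i.2 h

/-- By the multinomial theorem, the constant `c` of the statement is the functional given by `a` at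
`L^(d-1)`. -/
theorem evalForm_yForm_pow (a : PerazzoIdx m d → K) (b : Fin m → K) :
    evalForm a (yForm b ^ (d - 1)) = pairing a b := by
  refine Finset.sum_congr rfl fun i _ => ?_
  rw [coeff_yForm_pow]
  ring

/-- The start of the dual string of the monomial `y^v`. -/
def dualStart (d : ℕ) (b : Fin m → K) (k₀ : Fin m) (v : strings d k₀) : Alg K m d :=
  dualMon d b k₀ (expoAt v (len v - 1))

theorem yForm_pow_mul_dualStart (hb : b k₀ ≠ 0) (v : strings d k₀) {i j : ℕ}
    (h : i + j + 1 = len v) :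
    yc K m d (yForm b) ^ j * dualStart d b k₀ v = dualMon d b k₀ (expoAt v i) := by
  have h1 : expoAt v (len v - 1) = expoAt v i + Finsupp.single k₀ j := by
    rw [expoAt, expoAt, add_assoc, ← Finsupp.single_add, ← h, Nat.add_sub_cancel]
  rw [dualStart, h1, yForm_pow_mul_dualMon hb]
  rw [← h1, degree_expoAt]
  simp only [len] at h ⊢
  omega

/-- The error of the string at `v` comes from `φ` times a form of degree `d - 1`, hence is a
multiple of `dualMon 0`, the end of the top dual string. -/
theorem isDualStringBasis (hb : b k₀ ≠ 0) (hd : 0 < d) (a : PerazzoIdx m d → K) :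
    IsDualStringBasis K (yc K m d (yForm b)) (xForm a) (len (d := d) (k₀ := k₀)) (top hd k₀)
      (fun v => yMon d b k₀ v.1) (dualStart d b k₀)
      (fun v => evalForm a (yForm b ^ (len v - 1) * subst b k₀ (monomial v.1 1))) := by
  have hlt : ∀ v : strings d k₀, (expoAt v (len v - 1)).degree < d := fun v => by
    rw [degree_expoAt]
    have := degree_lt v
    simp only [len]
    omega
  have hdual : ∀ S : Submodule K (Alg K m d),
      (∀ v j, yc K m d (yForm b) ^ j * dualStart d b k₀ v ∈ S) →
      ∀ u : Fin m →₀ ℕ, u.degree < d → dualMon d b k₀ u ∈ S := by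
    intro S hS u hu
    obtain ⟨v, j, hj, rfl⟩ := exists_expoAt (k₀ := k₀) hu
    rw [← yForm_pow_mul_dualStart hb v (i := j) (j := len v - 1 - j) (by omega)]
    exact hS _ _
  refine ⟨len_pos, ?_, xForm_mul_self a, ?_, ?_, ?_, ?_, ?_, ?_, finrank_alg hb hd⟩
  · intro v hv
    rw [len_top]
    have := (eq_top_iff_degree hd v).not.1 hv
    simp only [len]
    omega
  · exact fun v => xForm_mul_of_xc_mul (fun i => xc_mul_dualMon i _) a
  · intro v
    rw [yForm_pow_mul_yMon]
    refine yMon_eq_zero ?_ hd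
    rw [map_add, Finsupp.degree_single]
    simp only [len]
    omega
  · intro v
    refine yForm_pow_mul_dualMon_eq_zero hb ?_ (hlt v)
    have := len_pos v
    simp only [expoAt, Finsupp.add_apply, apply_eq_zero, Finsupp.single_eq_same]
    omega
  · intro v
    have hE : (expoAt (top hd k₀) 0 : Fin m →₀ ℕ) = 0 := by simp [expoAt, top]
    rw [yForm_pow_mul_dualStart hb (top hd k₀) (i := 0) (j := len (top hd k₀) - 1)
      (by have := len_pos (top hd k₀); omega), hE, yMon, ← map_pow, ← map_mul]
    refine xForm_mul_yc hb hd a ?_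
    have h1 := ((isHomogeneous_yForm b).pow (len v - 1)).mul
      (isHomogeneous_subst (b := b) (k₀ := k₀) (isHomogeneous_monomial (d := v.1) (1 : K) rfl))
    have h2 := degree_lt v
    rwa [show 1 * (len v - 1) + v.1.degree = d - 1 by simp only [len]; omega] at h1
  · intro S hS z
    refine mem_of_xc_mul_eq_zero hb hd (hdual S hS) fun i => ?_
    rw [← mul_assoc, xc_mul_xForm, zero_mul]
  · intro S hE hD
    refine eq_top_of_mem hb hd (fun u hu => ?_) (hdual S hD)
    obtain ⟨v, j, hj, rfl⟩ := exists_expoAt (k₀ := k₀) hu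
    rw [expoAt, ← yForm_pow_mul_yMon]
    exact hE v j

/-! ### Degrees of the starts of the strings. -/

theorem dualStart_mem_gradedPiece (v : strings d k₀) :
    dualStart d b k₀ v ∈ gradedPiece (fullPerazzoForm K m d) 1 := by
  have h := degree_expoAt v (len v - 1)
  have h2 := degree_lt v
  simp only [len] at h
  have h3 := dualMon_mem_gradedPiece (K := K) (b := b) (k₀ := k₀) (u := expoAt v (len v - 1))
    (d := d) (by simp only [len]; omega)
  -- Every string of monomials ends in degree `d - 1`, so every dual string starts in degree 1,
  -- whatever its length.
  rwa [show d - (expoAt v (len v - 1)).degree = 1 by simp only [len]; omega] at h3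

theorem yForm_mem_gradedPiece :
    yc K m d (yForm b) ∈ gradedPiece (fullPerazzoForm K m d) 1 :=
  yc_mem_gradedPiece (isHomogeneous_yForm b)

theorem xForm_mem_gradedPiece (a : PerazzoIdx m d → K) :
    xForm a ∈ gradedPiece (fullPerazzoForm K m d) 1 :=
  Submodule.sum_mem _ fun i _ => Submodule.smul_mem _ _ (xc_mem_gradedPiece i)

theorem start_mem_gradedPiece (hd : 0 < d) (c : strings d k₀ → K) {v : strings d k₀}
    (hv : v ≠ top hd k₀ ∨ c v = 0) :
    IsDualStringBasis.start (yc K m d (yForm b)) (len (d := d) (k₀ := k₀)) (top hd k₀)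
      (fun v => yMon d b k₀ v.1) (dualStart d b k₀) c v ∈
      gradedPiece (fullPerazzoForm K m d) v.1.degree := by
  refine Submodule.sub_mem _ (yMon_mem_gradedPiece _) ?_
  rcases hv with hv | hv
  · refine Submodule.smul_mem _ _ ?_
    have h1 := mul_mem_gradedPiece
      (pow_mem_gradedPiece (yForm_mem_gradedPiece (d := d) (b := b)) (len (top hd k₀) - 1 - len v))
      (dualStart_mem_gradedPiece (b := b) (top hd k₀))
    have h2 := (eq_top_iff_degree hd v).not.1 hv
    have h3 := degree_lt v
    -- The correction has degree `d - len v`, which is the degree of `y^v`.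
    rwa [show 1 * (len (top hd k₀) - 1 - len v) + 1 = v.1.degree by
      rw [len_top]; simp only [len]; omega] at h1
  · simp [hv]

theorem mk_linForm (a : PerazzoIdx m d → K) (b : Fin m → K) :
    Ideal.Quotient.mk (annIdeal (fullPerazzoForm K m d)) (linForm a b) =
      yc K m d (yForm b) + xForm a := by
  have h : ∀ (c : K) (f : MvPolynomial (PerazzoVar m d) K),
      Ideal.Quotient.mk (annIdeal (fullPerazzoForm K m d)) (C c * f) =
        c • Ideal.Quotient.mk _ f := fun c f => by
    rw [← smul_eq_C_mul]; rfl
  rw [linForm, map_add, map_sum, map_sum, add_comm]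
  congr 1
  · rw [yForm, map_sum]
    refine Finset.sum_congr rfl fun k _ => ?_
    rw [yc_apply, map_mul (rename _), rename_C, rename_X]
  · exact Finset.sum_congr rfl fun i _ => h _ _

/-- The bases above require a nonzero `b k₀`; an auxiliary all-ones `b` serves here, so that the
result is available when the given `b` is zero. -/
theorem finite_alg (k₀ : Fin m) (hd : 0 < d) : Module.Finite K (Alg K m d) := by
  classical
  let b : Fin m → K := fun _ => 1
  refine ⟨⟨(smallExpos m d).image (yMon d b k₀) ∪ (smallExpos m d).image (dualMon d b k₀), ?_⟩⟩
  refine eq_top_of_mem (b := b) (k₀ := k₀) one_ne_zero hd (fun u hu => ?_) fun u hu => ?_ <;>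
    refine Submodule.subset_span ?_ <;> rw [Finset.coe_union, Finset.coe_image, Finset.coe_image]
  · exact Or.inl ⟨u, mem_smallExpos.2 hu, rfl⟩
  · exact Or.inr ⟨u, mem_smallExpos.2 hu, rfl⟩

/-! ### Counting strings by length and degree. -/

theorem sum_range_eq_degreeTail (hm : 2 ≤ m) :
    ∑ e ∈ Finset.range (d - 2), ((m - 1 + (e + 2) - 1).choose (e + 2)) •
      (({(d - (e + 2), e + 2)} : Multiset (ℕ × ℕ)) + {(d - (e + 2), 1)}) = degreeTail m d := by
  -- A monomial of degree `e + 2` starts a string of length `p = d - 2 - e`.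
  refine Finset.sum_nbij' (fun e => d - 2 - e) (fun p => d - 2 - p) ?_ ?_ ?_ ?_ ?_
  · intro e he
    simp only [Finset.mem_range, Finset.mem_Icc] at *
    omega
  · intro e he
    simp only [Finset.mem_range, Finset.mem_Icc] at *
    omega
  · intro e he
    simp only [Finset.mem_range] at *
    omega
  · intro e he
    simp only [Finset.mem_Icc] at *
    omega
  · intro e he
    simp only [Finset.mem_range] at he
    rw [smul_add, Multiset.nsmul_singleton, Multiset.nsmul_singleton, add_comm,
      ← Nat.choose_symm (n := m - 1 + (e + 2) - 1) (by omega)]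
    rw [show m - 1 + (e + 2) - 1 - (e + 2) = m - 2 by omega,
      show m + d - 2 - (d - 2 - e) = m - 1 + (e + 2) - 1 by omega,
      show d - (d - 2 - e) = e + 2 by omega, show d - (e + 2) = d - 2 - e by omega]

/-- Degrees 0 and 1 are split off: the value at 0 distinguishes the two Jordan degree types, and at
1 the two starting degrees coincide. -/
theorem sum_range_eq (hm : 2 ≤ m) (hd : 2 ≤ d) (f : ℕ → Multiset (ℕ × ℕ))
    (hf : ∀ e, 2 ≤ e → f e = {(d - e, e)} + {(d - e, 1)}) :
    ∑ e ∈ Finset.range d, ((m - 1 + e - 1).choose e) • f e =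
      f 0 + (m - 1) • f 1 + degreeTail m d := by
  rw [← sum_range_eq_degreeTail hm]
  obtain ⟨n, rfl⟩ := Nat.exists_eq_add_of_le' hd
  rw [Finset.sum_range_succ', Finset.sum_range_succ', Nat.add_sub_cancel,
    Finset.sum_congr rfl fun e _ => by rw [add_assoc, hf (e + (1 + 1)) (by omega)]]
  simp
  abel

theorem map_fst_degreeTail (m d : ℕ) :
    (degreeTail m d).map Prod.fst =
      ∑ p ∈ Finset.Icc 1 (d - 2), Multiset.replicate (2 * (m + d - 2 - p).choose (m - 2)) p := by
  rw [degreeTail, ← Multiset.coe_mapAddMonoidHom, map_sum]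
  refine Finset.sum_congr rfl fun p _ => ?_
  simp [two_mul, Multiset.replicate_add]

theorem map_fst_middleDegreeType (hd : 2 ≤ d) :
    (middleDegreeType m d).map Prod.fst = middleType m d := by
  obtain ⟨n, rfl⟩ := Nat.exists_eq_add_of_le' hd
  simp only [middleDegreeType, middleType, Multiset.map_add, map_fst_degreeTail]
  rw [show n + 2 - 1 = n + 1 by omega, Finset.sum_Icc_succ_top (by omega),
    show m + (n + 2) - 2 - (n + 1) = m - 1 by omega]
  simp only [Nat.add_sub_cancel, Multiset.map_singleton, Multiset.map_replicate]
  rw [Multiset.replicate_succ, Multiset.replicate_one, ← Multiset.singleton_add]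
  abel

theorem map_fst_maxDegreeType (m d : ℕ) :
    (maxDegreeType m d).map Prod.fst = maxType m d := by
  simp [maxDegreeType, maxType, Multiset.map_add, map_fst_degreeTail]

theorem evalForm_top (hd : 0 < d) (a : PerazzoIdx m d → K) :
    evalForm a (yForm b ^ (len (top hd k₀) - 1) * subst b k₀ (monomial (top hd k₀).1 1)) =
      pairing a b := by
  rw [len_top, show (top hd k₀).1 = 0 from rfl, show monomial 0 (1 : K) = 1 from rfl, map_one,
    mul_one, evalForm_yForm_pow]

theorem isJordanDegreeType_middle (hm : 2 ≤ m) (hd : 2 ≤ d) (hb : b k₀ ≠ 0)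
    (a : PerazzoIdx m d → K) (hc : pairing a b = 0) :
    IsJordanDegreeType (fullPerazzoForm K m d) (yc K m d (yForm b) + xForm a)
      (middleDegreeType m d) := by
  have hd0 : 0 < d := by omega
  have h := isDualStringBasis hb hd0 a
  have hc' : evalForm a (yForm b ^ (len (top hd0 k₀) - 1) *
      subst b k₀ (monomial (top hd0 k₀).1 1)) = 0 := by
    rwa [evalForm_top]
  let e := (Fintype.equivFin (strings d k₀ ⊕ strings d k₀)).symm
  let ν : strings d k₀ ⊕ strings d k₀ → ℕ := Sum.elim (fun v => v.1.degree) fun _ => 1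
  refine ⟨_, _, ν ∘ e, _, h.isJordanBasis_of_eq_zero hc' e, fun k => ?_, ?_⟩
  · simp only [Function.comp_apply]
    rcases e k with v | v
    · simp only [ν, Sum.elim_inl]
      by_cases hv : v = top hd0 k₀
      · subst hv
        exact start_mem_gradedPiece hd0 _ (Or.inr hc')
      · exact start_mem_gradedPiece hd0 _ (Or.inl hv)
    · exact dualStart_mem_gradedPiece v
  · refine (map_univ_eq_sum_singleton e fun k => (Sum.elim len len k, ν k)).trans ?_
    rw [Fintype.sum_sum_type, ← Finset.sum_add_distrib]
    refine (sum_strings (d := d) (k₀ := k₀)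
      fun e => ({(d - e, e)} : Multiset (ℕ × ℕ)) + {(d - e, 1)}).trans ?_
    -- The `m - 1` monomials of degree 1 and their duals give `2 (m - 1)` strings `(d - 1)_1`.
    rw [sum_range_eq hm hd _ fun _ _ => rfl, middleDegreeType, smul_add,
      Multiset.nsmul_singleton, ← Multiset.replicate_add, ← two_mul, Nat.sub_zero,
      ← Nat.choose_symm (n := m - 1) (k := m - 2) (by omega),
      show m - 1 - (m - 2) = 1 by omega, Nat.choose_one_right]

theorem isJordanDegreeType_max (hm : 2 ≤ m) (hd : 2 ≤ d) (hb : b k₀ ≠ 0)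
    (a : PerazzoIdx m d → K) (hc : pairing a b ≠ 0) (hdK : (d : K) ≠ 0) :
    IsJordanDegreeType (fullPerazzoForm K m d) (yc K m d (yForm b) + xForm a)
      (maxDegreeType m d) := by
  have hd0 : 0 < d := by omega
  have h := isDualStringBasis hb hd0 a
  have hc' : evalForm a (yForm b ^ (len (top hd0 k₀) - 1) *
      subst b k₀ (monomial (top hd0 k₀).1 1)) ≠ 0 := by
    rwa [evalForm_top]
  let e := (Fintype.equivFin (strings d k₀ ⊕ strings d k₀)).symm
  let ν : strings d k₀ ⊕ strings d k₀ → ℕ := Sum.elim (fun v => v.1.degree) fun _ => 1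
  have hL : yc K m d (yForm b) + xForm a ∈ gradedPiece (fullPerazzoForm K m d) 1 :=
    Submodule.add_mem _ yForm_mem_gradedPiece (xForm_mem_gradedPiece a)
  have htop : (top hd0 k₀).1.degree = 0 := (eq_top_iff_degree hd0 _).1 rfl
  refine ⟨_, _, ν ∘ e, _, h.isJordanBasis_of_ne_zero hc' (by rwa [len_top])
    (by rwa [len_top]) e, fun k => ?_, ?_⟩
  · simp only [Function.comp_apply]
    rcases e k with v | v <;> by_cases hv : v = top hd0 k₀
    · subst hv
      simpa [ν] using yMon_mem_gradedPiece (top hd0 k₀).1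
    · simpa [ν, hv] using start_mem_gradedPiece hd0 _ (Or.inl hv)
    · subst hv
      simp only [ν, Sum.elim_inr, Function.update_self]
      refine Submodule.sub_mem _ ?_ (Submodule.smul_mem _ _ (dualStart_mem_gradedPiece _))
      have := mul_mem_gradedPiece hL
        (yMon_mem_gradedPiece (d := d) (b := b) (k₀ := k₀) (top hd0 k₀).1)
      rwa [htop] at this
    · simpa [ν, hv] using dualStart_mem_gradedPiece v
  · refine (map_univ_eq_sum_singleton e fun k => (Sum.elim
      (Function.update len (top hd0 k₀) (len (top hd0 k₀) + 1))
      (Function.update len (top hd0 k₀) (len (top hd0 k₀) - 1)) k, ν k)).trans ?_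
    rw [Fintype.sum_sum_type, ← Finset.sum_add_distrib]
    have h1 : ∀ v : strings d k₀, ∀ x, Function.update len (top hd0 k₀) x v =
        if v.1.degree = 0 then x else d - v.1.degree := fun v x => by
      rw [Function.update_apply]
      exact if_congr (eq_top_iff_degree hd0 v) rfl rfl
    simp only [Sum.elim_inl, Sum.elim_inr, ν, h1, len_top]
    refine (sum_strings (d := d) (k₀ := k₀) fun e => ({(if e = 0 then d + 1 else d - e, e)} :
      Multiset (ℕ × ℕ)) + {(if e = 0 then d - 1 else d - e, 1)}).trans ?_
    rw [sum_range_eq hm hd _ fun e he => by simp [show e ≠ 0 by omega], maxDegreeType, smul_add]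
    simp only [if_true, one_ne_zero, if_false]
    -- The shortened top dual string joins the `2 (m - 1)` strings `(d - 1)_1`, hence `2 m - 1`.
    rw [Multiset.nsmul_singleton, ← Multiset.replicate_add, add_assoc {(d + 1, 0)},
      ← Multiset.replicate_one (d - 1, 1), ← Multiset.replicate_add,
      show 1 + (m - 1 + (m - 1)) = 2 * m - 1 by omega]

end Perazzo
end

theorem theorem3p2 {K : Type*} [Field K] [Infinite K] (m d : ℕ) (hm : 2 ≤ m) (hd : 3 ≤ d)
    (hchar : ringChar K = 0 ∨ d < ringChar K)
    (a : PerazzoIdx m d → K) (b : Fin m → K)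
    (F : DPSpace (PerazzoVar m d) K) (hF : F = fullPerazzoForm K m d)
    (ℓ : MacaulayAlg F) (hℓ : ℓ = Ideal.Quotient.mk (annIdeal F) (linForm a b)) :
    (b ≠ 0 → pairing a b = 0 →
      IsJordanType K ℓ (middleType m d) ∧ IsJordanDegreeType F ℓ (middleDegreeType m d)) ∧
    (b ≠ 0 → pairing a b ≠ 0 →
      IsJordanType K ℓ (maxType m d) ∧ IsJordanDegreeType F ℓ (maxDegreeType m d)) ∧
    (b = 0 →
      ∃ r t : ℕ, r = Module.finrank K (MacaulayAlg (contract (linForm a b) F)) ∧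
        2 * r + t = Module.finrank K (MacaulayAlg F) ∧
        IsJordanType K ℓ (Multiset.replicate r 2 + Multiset.replicate t 1)) := by

  subst hF hℓ
  rw [Perazzo.mk_linForm]
  have hd0 : 0 < d := by omega
  -- The factor `d` of the error on the string of `1` must be invertible; a positive characteristic
  -- above `d` cannot divide `d`.
  have hdK : (d : K) ≠ 0 := by
    intro h
    have h1 := (ringChar.spec K d).1 h
    rcases hchar with h0 | h0
    · rw [h0, zero_dvd_iff] at h1
      omega
    · exact absurd (Nat.le_of_dvd hd0 h1) (by omega)
  refine ⟨fun hb hc => ?_, fun hb hc => ?_, fun hb => ?_⟩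
  · obtain ⟨k, hk⟩ := Function.ne_iff.1 hb
    have h := Perazzo.isJordanDegreeType_middle hm (by omega) hk a hc
    exact ⟨Perazzo.map_fst_middleDegreeType (m := m) (d := d) (by omega) ▸ h.isJordanType, h⟩
  · obtain ⟨k, hk⟩ := Function.ne_iff.1 hb
    have h := Perazzo.isJordanDegreeType_max hm (by omega) hk a hc hdK
    exact ⟨Perazzo.map_fst_maxDegreeType m d ▸ h.isJordanType, h⟩
  · have := Perazzo.finite_alg (K := K) (⟨0, by omega⟩ : Fin m) hd0
    have hsq : (Perazzo.yc K m d (Perazzo.yForm b) + Perazzo.xForm a) *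
        (Perazzo.yc K m d (Perazzo.yForm b) + Perazzo.xForm a) = 0 := by
      have h0 : Perazzo.yForm b = 0 := by simp [Perazzo.yForm, hb]
      rw [h0, map_zero, zero_add, Perazzo.xForm_mul_self]
    obtain ⟨t, ht, hJ⟩ := isJordanType_of_sq_eq_zero (K := K) hsq
    refine ⟨_, t, ?_, ht, hJ⟩
    rw [finrank_macaulayAlg_contract, Perazzo.mk_linForm]
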